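/- **Setting.** A bosonic Abelian topological order $\mathcal C$ is a finite abelian group $A$ of anyons with topological twists $\theta:A\to U(1)$ such that $\theta_{-a}=\theta_a$ and the braiding $B(a,b)=\theta_{a+b}/(\theta_a\theta_b)$ is bimultiplicative and nondegenerate. Put $\mathcal D^2=|A|=\prod_j p_j^{k_j}$ (distinct primes $p_j$, $k_j\ge 1$), let $N_{\rm FS}$ be the least positive integer with $\theta_a^{N_{\rm FS}}=1$ for all $a$, let $G_n(\mathcal C)=\sum_{a}\theta_a^n$, and $\zeta_n(\mathcal C)=G_n(\mathcal C)/|G_n(\mathcal C)|$ (when $G_n(\mathcal C)\neq0$). $\mathcal C$ admits a gapped edge if it has a Lagrangian subgroup: a subgroup $L\subseteq A$ with $\theta|_L=1$ that contains every anyon braiding trivially with all of $L$. Let $\mathcal C_{p}$ be the theory of the anyons of $p$-power order, let $\tilde k_j=k_j+1$ if $p_j=2$ and $\tilde k_j=k_j$ otherwise, and write $n_{j,m}=m\cdot 2\mathcal D^2/p_j^{\tilde k_j}$. An edge theory of $\mathcal C$ is a unitary, possibly non-chiral, conformal field theory with central charges $(c,\bar c)$, $c_-=c-\bar c$, whose states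 have weights $h,\bar h\ge0$ and lie in sectors $a\in A$, with $e^{2\pi i(h-\bar h)}=\theta_a$ in sector $a$, with a unique state of weights $(0,0)$ (the vacuum), which lies in sector $0$, and with $\sum e^{-2\pi y(h+\bar h)}<\infty$ for all $y>0$, and whose characters $\chi_a(\tau)=\mathrm{Tr}_a\, q^{L_0-c/24}\,\bar q^{\bar L_0-\bar c/24}$, $q=e^{2\pi i\tau}$, satisfy $\chi_a(-1/\tau)=\sum_b S_{ab}\chi_b(\tau)$ with $S_{ab}=\mathcal D^{-1}\theta_{a-b}/(\theta_a\theta_b)$. The partial rotation in the trivial sector is $$\mathcal T_1\!\left(\tfrac{2\pi}{n}\right)=\frac{\chi_0(iu+\frac1n)\,\chi_0(iv-\frac1n)}{\chi_0(iu)\,\chi_0(iv)},\qquad u=\xi_l/L,\quad v=\xi_r/L ,$$ where $L$ is the circumference of the cylinder and $\xi_l,\xi_r$ are the correlation lengths of its two edges. For $|z|=1$ write $\mathcal T_1(2\pi/n)\propto z$ if $\mathcal T_1/|\mathcal T_1|\to z$ as $u\to\infty$ and $v\to0^+$. Put $\omega_n=e^{-2\pi i(\frac2n+n)\frac{c_-}{24}}$.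 The edge is gappable if $c_-=0$ and $\mathcal C$ has a Lagrangian subgroup. **Theorem.** Let $\mathcal C$ be a bosonic Abelian topological order. 1. $N_{\rm FS}$ divides $2\mathcal D^2$. There is an equivalence $\mathcal C\simeq\boxtimes_j\mathcal C_{p_j}$, where $\mathcal C_{p_j}$ has $p_j^{k_j}$ anyons. Moreover $N_{\rm FS}=\prod_j N_j$, where $N_j=N_{\rm FS}(\mathcal C_{p_j})=p_j^{l_j}$ with $1\le l_j\le\tilde k_j$. 2. $\mathcal C$ admits a gapped edge if and only if every $\mathcal C_{p_j}$ does, and $\mathcal C_{p_j}$ does if and only if $\zeta_n(\mathcal C_{p_j})=1$ for all $1\le n\le N_j$ with $\gcd(n,p_j)=1$. 3. For every $j$ and every $m$ with $\gcd(m,p_j)=1$, with $n=n_{j,m}$: $G_n(\mathcal C_{p_j})\ne0$ and $G_n(\mathcal C)$ is a positive real multiple of $\zeta_n(\mathcal C_{p_j})$. For every $n'$ with $1\le n'\le N_j$ and $\gcd(n',p_j)=1$ there is $1\le m\le p_j^{\tilde k_j}$ with $\gcd(m,p_j)=1$, $n_{j,m}\equiv n' \pmod{N_j}$ and $\zeta_{n_{j,m}}(\mathcal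 C_{p_j})=\zeta_{n'}(\mathcal C_{p_j})$. 4. For every edge theory of $\mathcal C$: $\mathcal T_1(2\pi/n)\propto\omega_n\,\zeta_n(\mathcal C)$ for every $n\ge1$ with $G_n(\mathcal C)\ne0$; in particular $\mathcal T_1(2\pi/(2\mathcal D^2))\propto\omega_{2\mathcal D^2}$, and $\mathcal T_1(2\pi/n)\propto\omega_n\,\zeta_n(\mathcal C_{p_j})$ for $n=n_{j,m}$ with $\gcd(m,p_j)=1$. 5. Consequently, for every edge theory, $\mathcal C$ admits a gapped edge if and only if $\mathcal T_1(2\pi/n_{j,m})\propto\omega_{n_{j,m}}$ for all $j$ and all $1\le m\le p_j^{\tilde k_j}$ with $\gcd(m,p_j)=1$; and the edge is gappable if and only if $c_-=0$ and $\mathcal T_1(2\pi/n_{j,m})\propto1$ for all these $j$ and $m$. -/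

import Mathlib

open Filter Topology

noncomputable section

/-- The mutual braiding phase `θ(a+b) / (θ(a) θ(b))` attached to a topological spin function. -/
def braidingPhase {A : Type*} [AddCommGroup A] (θ : A → Circle) (a b : A) : Circle :=
  θ (a + b) / (θ a * θ b)

/-- A bosonic Abelian topological order (pointed modular category): the anyons form an abelian
group `A` under fusion (finiteness is the separate assumption `[Finite A]`), the topological
twist `θ` is a quadratic function, and the mutual braiding is nondegenerate. -/
structure AbelianTQFT (A : Type*) [AddCommGroup A] where
  θ : A → Circle
  θ_neg : ∀ a, θ (-a) = θ a
  braiding_add_left : ∀ a b c,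
    braidingPhase θ (a + b) c = braidingPhase θ a c * braidingPhase θ b c
  nondegenerate : ∀ a, (∀ b, braidingPhase θ a b = 1) → a = 0

namespace AbelianTQFT

/-- `𝒟² = ∑ d_a²`; every anyon of an Abelian theory has quantum dimension `d_a = 1`. -/
def dimSq {A : Type*} [AddCommGroup A] (_C : AbelianTQFT A) : ℕ := Nat.card A

/-- The mutual braiding of two anyons. -/
def braiding {A : Type*} [AddCommGroup A] (C : AbelianTQFT A) (a b : A) : Circle :=
  braidingPhase C.θ a b

/-- The Frobenius–Schur exponent: the least `N > 0` with `θ_a ^ N = 1` for all anyons `a`. -/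
def fsExponent {A : Type*} [AddCommGroup A] (C : AbelianTQFT A) : ℕ :=
  sInf {N : ℕ | 0 < N ∧ ∀ a, C.θ a ^ N = 1}

/-- The Gauss sum `∑ d_a² θ_a ^ n` (with `d_a = 1`). -/
def gaussSum {A : Type*} [AddCommGroup A] (C : AbelianTQFT A) (n : ℕ) : ℂ :=
  ∑ᶠ a : A, ((C.θ a : Circle) : ℂ) ^ n

/-- The higher central charge `ζ_n`, the phase of the `n`-th Gauss sum. -/
def higherCentralCharge {A : Type*} [AddCommGroup A] (C : AbelianTQFT A) (n : ℕ) : ℂ :=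
  C.gaussSum n / (‖C.gaussSum n‖ : ℂ)

/-- The modular `S`-matrix `S_ab = 𝒟⁻¹ ∑_c N_{a b̄}^c θ_c / (θ_a θ_b)`; for an Abelian theory
the only fusion channel is `c = a - b`. -/
def modularS {A : Type*} [AddCommGroup A] (C : AbelianTQFT A) (a b : A) : ℂ :=
  ((C.θ (a - b) / (C.θ a * C.θ b) : Circle) : ℂ) / (Real.sqrt C.dimSq : ℂ)

/-- `L` is a Lagrangian subgroup: a group of bosons that contains every anyon braiding trivially
with all of `L`. -/
def IsLagrangian {A : Type*} [AddCommGroup A] (C : AbelianTQFT A) (L : AddSubgroup A) : Prop :=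
  (∀ a ∈ L, C.θ a = 1) ∧ ∀ a, (∀ b ∈ L, C.braiding a b = 1) → a ∈ L

/-- The Abelian TQFT admits a gapped edge: a Lagrangian subgroup of anyons can be condensed. -/
def AdmitsGappedEdge {A : Type*} [AddCommGroup A] (C : AbelianTQFT A) : Prop :=
  ∃ L : AddSubgroup A, C.IsLagrangian L

/-- Equivalence of Abelian theories: a fusion isomorphism preserving the topological twists. -/
def Equivalent {A B : Type*} [AddCommGroup A] [AddCommGroup B]
    (C : AbelianTQFT A) (C' : AbelianTQFT B) : Prop :=
  ∃ e : A ≃+ B, ∀ a, C'.θ (e a) = C.θ a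

/-- The Deligne product (stacking) of finitely many Abelian theories. -/
def deligneProduct {ι : Type*} [Fintype ι] {A : ι → Type*} [∀ i, AddCommGroup (A i)]
    (C : ∀ i, AbelianTQFT (A i)) : AbelianTQFT (∀ i, A i) where
  θ a := ∏ i, (C i).θ (a i)
  θ_neg a := by simp [(C _).θ_neg]
  braiding_add_left a b c := by
    have h : ∀ a b : (∀ i, A i), braidingPhase (fun a : (∀ i, A i) => ∏ i, (C i).θ (a i)) a b
        = ∏ i, braidingPhase (C i).θ (a i) (b i) := by
      intro a b
      simp [braidingPhase, Finset.prod_div_distrib, Finset.prod_mul_distrib]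
    rw [h, h, h, ← Finset.prod_mul_distrib]
    exact Finset.prod_congr rfl fun i _ => (C i).braiding_add_left _ _ _
  nondegenerate a ha := by
    classical
    have h : ∀ a b : (∀ i, A i), braidingPhase (fun a : (∀ i, A i) => ∏ i, (C i).θ (a i)) a b
        = ∏ i, braidingPhase (C i).θ (a i) (b i) := by
      intro a b
      simp [braidingPhase, Finset.prod_div_distrib, Finset.prod_mul_distrib]
    have hz : ∀ i (x : A i), braidingPhase (C i).θ x 0 = 1 := by
      intro i x
      have h0 := (C i).braiding_add_left 0 0 0
      simp only [braidingPhase, add_zero] at h0 ⊢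
      rw [eq_comm, mul_eq_left] at h0
      simp only [div_mul_cancel_left, inv_eq_one] at h0
      simp [h0]
    funext i
    refine (C i).nondegenerate _ fun x => ?_
    have := ha (Pi.single i x)
    rw [h, Finset.prod_eq_single i] at this
    · simpa using this
    · intro j _ hj
      rw [Pi.single_eq_of_ne hj]
      exact hz j _
    · simp

theorem braidingPhase_comm {A : Type*} [AddCommGroup A] (θ : A → Circle) (a b : A) :
    braidingPhase θ a b = braidingPhase θ b a := by
  simp [braidingPhase, add_comm, mul_comm]

theorem braiding_nsmul_left {A : Type*} [AddCommGroup A] (C : AbelianTQFT A) (n : ℕ) (a b : A) :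
    braidingPhase C.θ (n • a) b = braidingPhase C.θ a b ^ n := by
  induction n with
  | zero =>
    have h0 := C.braiding_add_left 0 0 b
    rw [add_zero, eq_comm, mul_eq_left] at h0
    simpa using h0
  | succ k ih => rw [succ_nsmul, C.braiding_add_left, ih, pow_succ]

/-- The factor `𝒞_p`: the anyons of `p`-power order with the same topological twists. -/
def primary {A : Type*} [AddCommGroup A] [Finite A] (C : AbelianTQFT A) (p : ℕ)
    [hp : Fact p.Prime] : AbelianTQFT (AddCommGroup.primaryComponent A p) where
  θ a := C.θ a
  θ_neg a := C.θ_neg a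
  braiding_add_left a b c := C.braiding_add_left a b c
  nondegenerate a ha := by
    obtain ⟨k, hk⟩ := a.2
    have hcop : Nat.Coprime (p ^ k) (ordCompl[p] (Nat.card A)) :=
      Nat.Coprime.pow_left _ (Nat.coprime_ordCompl hp.out Nat.card_pos.ne')
    obtain ⟨e, he1, he2⟩ := Nat.chineseRemainder hcop 1 0
    apply Subtype.ext
    refine C.nondegenerate _ fun b => ?_
    have hea : e • (a : A) = a := by
      have := (nsmul_eq_nsmul_iff_modEq (x := (a : A)) (n := e) (m := 1)).2
        (he1.of_dvd (addOrderOf_dvd_of_nsmul_eq_zero hk))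
      simpa using this
    have heb : e • b ∈ AddCommGroup.primaryComponent A p := by
      have hz : p ^ ((Nat.card A).factorization p) • (e • b) = 0 := by
        obtain ⟨d, rfl⟩ := (Nat.modEq_zero_iff_dvd).1 he2
        rw [← mul_nsmul', ← mul_assoc, Nat.ordProj_mul_ordCompl_eq_self, mul_nsmul]
        simp
      exact ⟨_, hz⟩
    have h1 : braidingPhase C.θ a (e • b) = 1 := ha ⟨_, heb⟩
    rw [braidingPhase_comm, braiding_nsmul_left, braidingPhase_comm,
      ← braiding_nsmul_left, hea] at h1
    exact h1

/-- The exponent `k_p` in `𝒟² = ∏ p ^ k_p`. -/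
def kExp {A : Type*} [AddCommGroup A] (C : AbelianTQFT A) (p : ℕ) : ℕ :=
  C.dimSq.factorization p

/-- `k̃_p = k_p + 1` for `p = 2` and `k̃_p = k_p` otherwise. -/
def kTilde {A : Type*} [AddCommGroup A] (C : AbelianTQFT A) (p : ℕ) : ℕ :=
  if p = 2 then C.kExp p + 1 else C.kExp p

/-- The integer `2 𝒟² / p ^ k̃_p` (an exact division when `p` divides `𝒟²`). -/
def rotationUnit {A : Type*} [AddCommGroup A] (C : AbelianTQFT A) (p : ℕ) : ℕ :=
  2 * C.dimSq / p ^ C.kTilde p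

instance primeFactors_fact {N : ℕ} (p : N.primeFactors) : Fact (p : ℕ).Prime :=
  ⟨Nat.prime_of_mem_primeFactors p.2⟩

end AbelianTQFT

/-- The spectrum of a (possibly non-chiral) unitary edge theory: states with conformal weights
`(h, hbar)`, each in a topological sector labelled by an anyon, with a unique vacuum of zero
energy in the trivial sector. Convergence of the thermal traces is `summable`. -/
structure EdgeSpectrum (A : Type*) [AddCommGroup A] where
  c : ℝ
  cbar : ℝ
  State : Type
  sector : State → A
  h : State → ℝ
  hbar : State → ℝ
  h_nonneg : ∀ s, 0 ≤ h s
  hbar_nonneg : ∀ s, 0 ≤ hbar s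
  vac : State
  sector_vac : sector vac = 0
  h_vac : h vac = 0
  hbar_vac : hbar vac = 0
  vac_unique : ∀ s, h s = 0 → hbar s = 0 → s = vac
  summable : ∀ y : ℝ, 0 < y → Summable fun s => Real.exp (-(2 * Real.pi * y * (h s + hbar s)))

namespace EdgeSpectrum

/-- The character `χ_a(τ) = Tr_a q^(L₀ - c/24) q̄^(L̄₀ - c̄/24)`, with `q = exp(2πiτ)`. -/
def character {A : Type*} [AddCommGroup A] (E : EdgeSpectrum A) (a : A) (τ : ℂ) : ℂ :=
  ∑' s : {s : E.State // E.sector s = a},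
    Complex.exp (2 * Real.pi * Complex.I * τ * ((E.h s - E.c / 24 : ℝ) : ℂ)) *
    Complex.exp (-(2 * Real.pi * Complex.I * (starRingEnd ℂ τ) *
      ((E.hbar s - E.cbar / 24 : ℝ) : ℂ)))

end EdgeSpectrum

/-- An edge conformal field theory of the topological order `C`: the spins of the sector `a` equal
the topological spin of `a` modulo one, and the characters transform under `τ ↦ -1/τ` with the
modular `S`-matrix of `C`. -/
structure EdgeCFT {A : Type*} [AddCommGroup A] (C : AbelianTQFT A) extends EdgeSpectrum A where
  spin : ∀ s, ((C.θ (sector s) : Circle) : ℂ) =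
    Complex.exp (2 * Real.pi * Complex.I * ((h s - hbar s : ℝ) : ℂ))
  modular : ∀ (a : A) (τ : ℂ), 0 < τ.im →
    toEdgeSpectrum.character a (-1 / τ) =
      ∑ᶠ b : A, C.modularS a b * toEdgeSpectrum.character b τ

namespace EdgeCFT

/-- The chiral central charge `c₋`. -/
def chiralCentralCharge {A : Type*} [AddCommGroup A] {C : AbelianTQFT A} (E : EdgeCFT C) : ℝ :=
  E.c - E.cbar

/-- The partial rotation `𝒯₁(2π/n)` of the cylinder in the trivial sector, as the expectation value
of the translation in the theories on the two edges of the rotated region; `u = ξ_l / L` and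
`v = ξ_r / L` are the correlation lengths in units of the circumference. -/
def partialRotation {A : Type*} [AddCommGroup A] {C : AbelianTQFT A} (E : EdgeCFT C)
    (n : ℕ) (u v : ℝ) : ℂ :=
  (E.character 0 (Complex.I * u + 1 / n) * E.character 0 (Complex.I * v - 1 / n)) /
    (E.character 0 (Complex.I * u) * E.character 0 (Complex.I * v))

/-- `𝒯₁(2π/n) ∝ z` up to positive real factors, for a unit complex number `z`: in the regime
`ξ_r ≪ L ≪ ξ_l` of the cylinder the phase of the partial rotation converges to `z`. -/
def HasRotationPhase {A : Type*} [AddCommGroup A] {C : AbelianTQFT A} (E : EdgeCFT C)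
    (n : ℕ) (z : ℂ) : Prop :=
  Tendsto (fun x : ℝ × ℝ => E.partialRotation n x.1 x.2 / (‖E.partialRotation n x.1 x.2‖ : ℂ))
    (atTop ×ˢ 𝓝[>] (0 : ℝ)) (𝓝 z)

/-- The known phase `exp(-2πi (2/n + n) c₋ / 24)`. -/
def chiralPhase {A : Type*} [AddCommGroup A] {C : AbelianTQFT A} (E : EdgeCFT C) (n : ℕ) : ℂ :=
  Complex.exp (-(2 * Real.pi * Complex.I * (2 / n + n) * (E.chiralCentralCharge : ℂ) / 24))

/-- The edge of the phase is gappable: vanishing chiral central charge and a Lagrangian subgroup. -/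
def EdgeGappable {A : Type*} [AddCommGroup A] {C : AbelianTQFT A} (E : EdgeCFT C) : Prop :=
  E.chiralCentralCharge = 0 ∧ C.AdmitsGappedEdge

end EdgeCFT

end

/-!
The anyons of a bosonic Abelian topological order form a finite abelian group `A` with a
nondegenerate quadratic function `θ`, so that `B(a, a) = θ_a ^ 2` and `θ_{ka} = θ_a ^ (k ^ 2)`.
Anyons of coprime orders braid trivially, hence `θ` is the product of its restrictions to the
primary components of `A`. The Gauss sums and the Frobenius–Schur exponent factor accordingly, and
the Lagrangian subgroups are the sums of Lagrangian subgroups of the factors.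

For a factor at `p`, the higher central charges with index prime to `p` decide whether there is a
Lagrangian subgroup. If `L` is any group of bosons, then averaging over translations by `L` shows
that the Gauss sum `G_n`, with `n` prime to `p`, localizes on `L^⊥` (`gaussSum_eq_sum_perp`). For a
Lagrangian `L` this gives `G_n = |L| > 0`. Conversely, let all these central charges be `1`, so that
`G_n = 𝒟` by `norm_gaussSum`, and let `L` be a maximal group of bosons. Averaging `G_n` over the
`n` prime to `p` replaces each twist on `L^⊥` by a normalized Ramanujan sum, which is `1` for a
boson and nonpositive otherwise (`sum_pow_coprime`). Therefore `𝒟` is at most the number of bosons in `L^⊥`. By maximality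
these lie in `L`, so `𝒟 ≤ |L|`, and `|L| |L^⊥| = 𝒟²` forces `L = L^⊥`
(`admitsGappedEdge_of_higherCentralCharge`). No classification of quadratic forms is needed.

The integer `2𝒟² / p ^ k̃` is prime to `p` and a multiple of the Frobenius–Schur exponents of the
other factors. At its multiples the Gauss sums of those factors are positive integers, and only the
phase of the factor at `p` remains; being invertible modulo `p ^ k̃`, it reaches all residues prime
to `p`.

For an edge theory, the trivial character at `iu + 1/n` is dominated by the vacuum as `u → ∞`. The
point `iv - 1/n` is the image under `S T ^ n S` of `1/n + i/(n²v)`, so as `v → 0⁺` the trivial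
character there is dominated by the vacuum too, now with the vacuum matrix element of `S T ^ n S` as
coefficient: this is `G_n / 𝒟²` up to the Casimir phase (`exists_character_near_cusp`). The phase of
the partial rotation is therefore `ζ_n` times the chiral phase (`hasRotationPhase`), and the
criterion for gappability follows from the arithmetic above by uniqueness of limits.
-/

noncomputable section

namespace AbelianTQFT

/-! ### Quadratic functions on finite abelian groups -/

section Basic

variable {A : Type*} [AddCommGroup A] (C : AbelianTQFT A)

theorem braiding_add_left' (a b c : A) :
    C.braiding (a + b) c = C.braiding a c * C.braiding b c :=
  C.braiding_add_left a b c

theorem braiding_comm (a b : A) : C.braiding a b = C.braiding b a :=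
  braidingPhase_comm C.θ a b

theorem braiding_add_right (a b c : A) :
    C.braiding a (b + c) = C.braiding a b * C.braiding a c := by
  rw [braiding_comm, braiding_add_left', braiding_comm C b, braiding_comm C c]

theorem braiding_zero_left (a : A) : C.braiding 0 a = 1 := by
  simpa using C.braiding_add_left' 0 0 a

theorem braiding_zero_right (a : A) : C.braiding a 0 = 1 := by
  rw [braiding_comm, braiding_zero_left]

theorem braiding_nsmul_left' (n : ℕ) (a b : A) : C.braiding (n • a) b = C.braiding a b ^ n :=
  braiding_nsmul_left C n a b

theorem braiding_nsmul_right (n : ℕ) (a b : A) : C.braiding a (n • b) = C.braiding a b ^ n := by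
  rw [braiding_comm, braiding_nsmul_left', braiding_comm]

theorem braiding_neg_left (a b : A) : C.braiding (-a) b = (C.braiding a b)⁻¹ := by
  rw [eq_inv_iff_mul_eq_one, ← braiding_add_left', neg_add_cancel, braiding_zero_left]

theorem θ_add (a b : A) : C.θ (a + b) = C.θ a * C.θ b * C.braiding a b := by
  simp [braiding, braidingPhase]

theorem θ_zero : C.θ 0 = 1 := by
  have h := C.braiding_zero_left 0
  simpa [braiding, braidingPhase] using h

theorem braiding_self (a : A) : C.braiding a a = C.θ a ^ 2 := by
  have h := C.θ_add (-a) a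
  rw [neg_add_cancel, θ_zero, θ_neg, braiding_neg_left, eq_mul_inv_iff_mul_eq, one_mul] at h
  rw [h, sq]

theorem θ_nsmul (k : ℕ) (a : A) : C.θ (k • a) = C.θ a ^ (k ^ 2) := by
  induction k with
  | zero => simp [θ_zero]
  | succ k ih =>
    rw [succ_nsmul, θ_add, ih, braiding_nsmul_left', braiding_self, ← pow_mul,
      ← pow_succ, ← pow_add]
    ring_nf

/-- The twist of an anyon of order `N` is a `2N`-th root of unity, because `B(a, a) = θ_a ^ 2`. -/
theorem θ_pow_two_mul {N : ℕ} {a : A} (h : N • a = 0) : C.θ a ^ (2 * N) = 1 := by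
  rw [pow_mul, ← braiding_self, ← braiding_nsmul_left', h, braiding_zero_left]

/-- For odd `N` the two relations `θ_{Na} = θ_a ^ (N ^ 2) = 1` and `θ_a ^ (2N) = 1` have
greatest common exponent `N`. -/
theorem θ_pow_of_odd {N : ℕ} (hN : Odd N) {a : A} (h : N • a = 0) : C.θ a ^ N = 1 := by
  have h1 : C.θ a ^ (N ^ 2) = 1 := by rw [← θ_nsmul, h, θ_zero]
  have h2 := C.θ_pow_two_mul h
  have h3 : N.gcd 2 = 1 := hN.coprime_two_right
  have := pow_gcd_eq_one.2 ⟨h1, h2⟩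
  rwa [sq, mul_comm 2 N, Nat.gcd_mul_left, h3, mul_one] at this

theorem dimSq_nsmul (a : A) : C.dimSq • a = 0 := card_nsmul_eq_zero'

section Exponent

variable [Finite A]

theorem dimSq_pos : 0 < C.dimSq := Nat.card_pos

theorem fsExponent_mem : 0 < C.fsExponent ∧ ∀ a, C.θ a ^ C.fsExponent = 1 :=
  Nat.sInf_mem (s := {N : ℕ | 0 < N ∧ ∀ a, C.θ a ^ N = 1})
    ⟨2 * C.dimSq, by have := C.dimSq_pos; lia, fun a => C.θ_pow_two_mul (C.dimSq_nsmul a)⟩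

theorem fsExponent_dvd_iff {n : ℕ} : C.fsExponent ∣ n ↔ ∀ a, C.θ a ^ n = 1 := by
  obtain ⟨hpos, hone⟩ := C.fsExponent_mem
  constructor
  · rintro ⟨d, rfl⟩ a
    rw [pow_mul, hone, one_pow]
  · intro h
    by_contra hn
    have hlt := Nat.mod_lt n hpos
    refine Nat.notMem_of_lt_sInf hlt
      ⟨Nat.pos_of_ne_zero fun h0 => hn (Nat.dvd_of_mod_eq_zero h0), fun a => ?_⟩
    have := h a
    rwa [← Nat.mod_add_div n C.fsExponent, pow_add, pow_mul, hone, one_pow, mul_one] at this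

theorem fsExponent_dvd_two_mul : C.fsExponent ∣ 2 * C.dimSq :=
  C.fsExponent_dvd_iff.2 fun a => C.θ_pow_two_mul (C.dimSq_nsmul a)

theorem fsExponent_dvd_of_odd (h : Odd C.dimSq) : C.fsExponent ∣ C.dimSq :=
  C.fsExponent_dvd_iff.2 fun a => C.θ_pow_of_odd h (C.dimSq_nsmul a)

end Exponent

/-! ### Gauss sums and orthogonal complements -/

/-- The anyons that braid trivially with all of `L`. -/
def perp (L : AddSubgroup A) : AddSubgroup A where
  carrier := {a | ∀ b ∈ L, C.braiding a b = 1}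
  zero_mem' b _ := C.braiding_zero_left b
  add_mem' ha hb c hc := by rw [braiding_add_left', ha c hc, hb c hc, one_mul]
  neg_mem' ha c hc := by rw [braiding_neg_left, ha c hc, inv_one]

theorem mem_perp {L : AddSubgroup A} {a : A} : a ∈ C.perp L ↔ ∀ b ∈ L, C.braiding a b = 1 :=
  Iff.rfl

theorem mem_perp_top {a : A} : a ∈ C.perp ⊤ ↔ a = 0 :=
  ⟨fun h => C.nondegenerate a fun b => h b trivial, by rintro rfl; exact zero_mem _⟩

theorem gaussSum_eq_sum [Fintype A] (n : ℕ) : C.gaussSum n = ∑ a, (C.θ a : ℂ) ^ n :=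
  finsum_eq_sum_of_fintype _

/-- The character `b ↦ B(a, b) ^ n`. -/
def braidingChar (n : ℕ) (a : A) : AddChar A ℂ where
  toFun b := (C.braiding a b : ℂ) ^ n
  map_zero_eq_one' := by simp [braiding_zero_right]
  map_add_eq_mul' b c := by simp [braiding_add_right, mul_pow]

theorem braidingChar_apply (n : ℕ) (a b : A) :
    C.braidingChar n a b = (C.braiding a b : ℂ) ^ n := rfl

theorem braiding_pow_eq_one_iff {n : ℕ} (hn : n.Coprime C.dimSq) (a b : A) :
    (C.braiding a b : ℂ) ^ n = 1 ↔ C.braiding a b = 1 := by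
  constructor
  · intro h
    have h1 : C.braiding a b ^ n = 1 := by
      apply Circle.ext
      simpa using h
    have h2 : C.braiding a b ^ C.dimSq = 1 := by
      rw [← braiding_nsmul_left', dimSq_nsmul, braiding_zero_left]
    simpa [hn.gcd_eq_one] using pow_gcd_eq_one.2 ⟨h1, h2⟩
  · intro h
    simp [h]

/-- Summing the `n`-th power of the braiding with `a` over a subgroup `L` detects whether `a` lies
in the orthogonal complement of `L`. -/
theorem sum_braiding_pow [Fintype A] (L : AddSubgroup A) [Fintype L] {n : ℕ}
    (hn : n.Coprime C.dimSq) (a : A) [Decidable (a ∈ C.perp L)] :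
    ∑ b : L, (C.braiding a b : ℂ) ^ n = if a ∈ C.perp L then (Nat.card L : ℂ) else 0 := by
  classical
  have h := AddChar.sum_eq_ite ((C.braidingChar n a).compAddMonoidHom L.subtype)
  simp only [AddChar.compAddMonoidHom_apply, AddSubgroup.subtype_apply, braidingChar_apply] at h
  rw [h, Nat.card_eq_fintype_card]
  refine if_congr ?_ rfl rfl
  rw [mem_perp, AddChar.ext_iff]
  simp [braidingChar_apply, C.braiding_pow_eq_one_iff hn]

theorem sum_braiding_pow_univ [Fintype A] [DecidableEq A] {n : ℕ} (hn : n.Coprime C.dimSq)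
    (a : A) : ∑ b : A, (C.braiding a b : ℂ) ^ n = if a = 0 then (Nat.card A : ℂ) else 0 := by
  classical
  have h := C.sum_braiding_pow ⊤ hn a
  simp only [mem_perp_top, AddSubgroup.card_top] at h
  rw [← h]
  exact Fintype.sum_equiv AddSubgroup.topEquiv.symm.toEquiv _ _ fun a => rfl

variable [Finite A]

/-- Nondegeneracy of the braiding gives `|L| |L^⊥| = |A|`. -/
theorem card_mul_card_perp (L : AddSubgroup A) :
    Nat.card L * Nat.card (C.perp L) = Nat.card A := by
  classical
  have := Fintype.ofFinite A
  have h1 : ∑ a : A, ∑ b : L, (C.braiding a b : ℂ) ^ 1 = Nat.card (C.perp L) * Nat.card L := by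
    simp_rw [C.sum_braiding_pow L (Nat.coprime_one_left _)]
    rw [← Finset.sum_filter, Finset.sum_const, nsmul_eq_mul]
    congr 2
    rw [Nat.card_eq_fintype_card, Fintype.card_subtype]
  have h2 : ∑ b : L, ∑ a : A, (C.braiding a b : ℂ) ^ 1 = Nat.card A := by
    simp_rw [fun a (b : L) => C.braiding_comm a b,
      C.sum_braiding_pow_univ (Nat.coprime_one_left _)]
    rw [Finset.sum_eq_single 0] <;> simp +contextual
  rw [Finset.sum_comm, h2] at h1
  rw [mul_comm]
  exact_mod_cast h1.symm

/-- For a subgroup `L` of bosons, the Gauss sum localizes on `L^⊥`: averaging over translations by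
`L` kills every coset that braids nontrivially with `L`. -/
theorem gaussSum_eq_sum_perp [Fintype A] (L : AddSubgroup A) (hL : ∀ a ∈ L, C.θ a = 1) {n : ℕ}
    (hn : n.Coprime C.dimSq) [DecidablePred (· ∈ C.perp L)] :
    C.gaussSum n = ∑ a with a ∈ C.perp L, (C.θ a : ℂ) ^ n := by
  classical
  have hc : (Nat.card L : ℂ) ≠ 0 := by exact_mod_cast Nat.card_pos.ne'
  have key : ∑ b : L, ∑ a, (C.θ (a + b) : ℂ) ^ n = Nat.card L * C.gaussSum n := by
    have : ∀ b : L, ∑ a, (C.θ (a + b) : ℂ) ^ n = C.gaussSum n := fun b => by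
      rw [gaussSum_eq_sum]
      exact Fintype.sum_equiv (Equiv.addRight (b : A)) _ _ fun a => rfl
    simp [this, Nat.card_eq_fintype_card]
  rw [Finset.sum_comm] at key
  have h2 : ∀ a, ∑ b : L, (C.θ (a + b) : ℂ) ^ n =
      if a ∈ C.perp L then (Nat.card L : ℂ) * (C.θ a : ℂ) ^ n else 0 := fun a => by
    have : ∀ b : L, (C.θ (a + b) : ℂ) ^ n = (C.θ a : ℂ) ^ n * (C.braiding a b : ℂ) ^ n :=
      fun b => by simp [θ_add, hL b b.2, mul_pow]
    simp_rw [this]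
    rw [← Finset.mul_sum, C.sum_braiding_pow L hn]
    split_ifs <;> ring
  simp_rw [h2] at key
  rw [← Finset.sum_filter, ← Finset.mul_sum] at key
  exact (mul_left_cancel₀ hc key).symm

/-- The Gauss sum has absolute value `𝒟` when `n` is prime to `𝒟²`, because the `n`-th power of the
braiding is then still nondegenerate. -/
theorem norm_gaussSum {n : ℕ} (hn : n.Coprime C.dimSq) :
    ‖C.gaussSum n‖ = Real.sqrt (Nat.card A) := by
  classical
  have := Fintype.ofFinite A
  suffices h : ‖C.gaussSum n‖ ^ 2 = Nat.card A by rw [← h, Real.sqrt_sq (norm_nonneg _)]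
  rw [← Complex.ofReal_inj]
  push_cast
  rw [← Complex.mul_conj']
  have hconj : (starRingEnd ℂ) (C.gaussSum n) = ∑ b, ((C.θ b : ℂ)⁻¹) ^ n := by
    rw [gaussSum_eq_sum, map_sum]
    refine Finset.sum_congr rfl fun b _ => ?_
    rw [map_pow, ← Circle.coe_inv_eq_conj, Circle.coe_inv]
  have hshift : ∀ b, C.gaussSum n = ∑ a, (C.θ (a + b) : ℂ) ^ n := fun b => by
    rw [gaussSum_eq_sum]
    exact (Fintype.sum_equiv (Equiv.addRight b) _ _ fun a => rfl).symm
  rw [hconj, Finset.mul_sum]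
  have : ∀ b, C.gaussSum n * ((C.θ b : ℂ)⁻¹) ^ n =
      ∑ a, (C.θ a : ℂ) ^ n * (C.braiding a b : ℂ) ^ n := fun b => by
    rw [hshift b, Finset.sum_mul]
    refine Finset.sum_congr rfl fun a _ => ?_
    have := Circle.coe_ne_zero (C.θ b)
    simp [θ_add, mul_pow]
    field_simp
  simp_rw [this]
  rw [Finset.sum_comm]
  simp_rw [← Finset.mul_sum]
  simp_rw [C.sum_braiding_pow_univ hn]
  rw [Finset.sum_eq_single 0] <;> simp +contextual [θ_zero]

theorem gaussSum_ne_zero {n : ℕ} (hn : n.Coprime C.dimSq) : C.gaussSum n ≠ 0 := by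
  rw [← norm_pos_iff, C.norm_gaussSum hn]
  have := C.dimSq_pos
  exact Real.sqrt_pos.2 (by exact_mod_cast this)

/-! ### Lagrangian subgroups and higher central charges -/

/-- For a Lagrangian subgroup `L` the Gauss sum localizes on `L^⊥ = L`, where every twist is `1`, so
it is the positive number `|L|`. -/
theorem higherCentralCharge_eq_one {n : ℕ} (hn : n.Coprime C.dimSq) (h : C.AdmitsGappedEdge) :
    C.higherCentralCharge n = 1 := by
  classical
  obtain ⟨L, hL, hL'⟩ := h
  have := Fintype.ofFinite A
  have hperp : ∀ a ∈ C.perp L, C.θ a = 1 := fun a ha => hL a (hL' a ha)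
  have hne := C.gaussSum_ne_zero hn
  have hG : C.gaussSum n = ((∑ a with a ∈ C.perp L, 1 : ℕ) : ℂ) := by
    rw [C.gaussSum_eq_sum_perp L hL hn, Nat.cast_sum]
    refine Finset.sum_congr rfl fun a ha => ?_
    rw [hperp a (Finset.mem_filter.1 ha).2]
    simp
  rw [higherCentralCharge, hG, Complex.norm_natCast, Complex.ofReal_natCast, div_self]
  rwa [← hG]

/-- A nontrivial root of unity of order dividing `p ^ l` has a nonpositive Ramanujan sum: the sum
of its powers with exponents prime to `p` is minus the sum over the multiples of `p`. -/
theorem sum_pow_coprime {p l : ℕ} (hp : p.Prime) (hl : 1 ≤ l) {z : ℂ} (hz : z ^ p ^ l = 1)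
    (hz1 : z ≠ 1) :
    ∃ r : ℕ, ∑ n ∈ Finset.range (p ^ l) with n.Coprime p, z ^ n = -(r : ℂ) := by
  obtain ⟨k, rfl⟩ : ∃ k, l = k + 1 := ⟨l - 1, by lia⟩
  have h0 : ∑ n ∈ Finset.range (p ^ (k + 1)), z ^ n = 0 := by
    rw [geom_sum_eq hz1, hz, sub_self, zero_div]
  rw [← Finset.sum_filter_add_sum_filter_not _ (fun n => n.Coprime p)] at h0
  have hmult : ∑ n ∈ Finset.range (p ^ (k + 1)) with ¬ n.Coprime p, z ^ n =
      ∑ j ∈ Finset.range (p ^ k), (z ^ p) ^ j := by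
    symm
    refine Finset.sum_bij (fun j _ => p * j) ?_ ?_ ?_ ?_
    · intro j hj
      simp only [Finset.mem_filter, Finset.mem_range] at hj ⊢
      refine ⟨?_, fun h => ?_⟩
      · rw [pow_succ']
        exact Nat.mul_lt_mul_of_pos_left hj hp.pos
      · exact hp.one_lt.ne' ((Nat.coprime_self p).1 (Nat.coprime_mul_iff_left.1 h).1)
    · intro i _ j _ h
      exact Nat.eq_of_mul_eq_mul_left hp.pos h
    · intro n hn
      simp only [Finset.mem_filter, Finset.mem_range] at hn
      rw [Nat.coprime_comm, hp.coprime_iff_not_dvd, not_not] at hn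
      obtain ⟨hn, j, rfl⟩ := hn
      refine ⟨j, ?_, rfl⟩
      rw [pow_succ'] at hn
      exact Finset.mem_range.2 (Nat.lt_of_mul_lt_mul_left hn)
    · intro j _
      rw [pow_mul]
  rw [hmult] at h0
  by_cases hzp : z ^ p = 1
  · refine ⟨p ^ k, ?_⟩
    rw [eq_neg_of_add_eq_zero_left h0, hzp]
    simp
  · refine ⟨0, ?_⟩
    rw [eq_neg_of_add_eq_zero_left h0, geom_sum_eq hzp, ← pow_mul, ← pow_succ', hz]
    simp

theorem higherCentralCharge_eq_one_iff {n : ℕ} (hn : n.Coprime C.dimSq) :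
    C.higherCentralCharge n = 1 ↔ C.gaussSum n = (Real.sqrt (Nat.card A) : ℂ) := by
  have h : (‖C.gaussSum n‖ : ℂ) ≠ 0 := by
    simpa using C.gaussSum_ne_zero hn
  rw [higherCentralCharge, div_eq_one_iff_eq h, C.norm_gaussSum hn]

/-- If the twists are `p ^ l`-th roots of unity and all the higher central charges prime to `p` are
trivial, then a maximal group of bosons is Lagrangian. Averaging the Gauss sums over the exponents
prime to `p` bounds `𝒟` by the number of bosons in `L^⊥`; these all lie in the maximal group `L`,
so `|L| ≥ 𝒟`, while `|L| |L^⊥| = 𝒟²`. -/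
theorem admitsGappedEdge_of_higherCentralCharge {p l k : ℕ} (hp : p.Prime) (hl : 1 ≤ l)
    (hcard : C.dimSq = p ^ k) (hθ : ∀ a, C.θ a ^ p ^ l = 1)
    (h : ∀ n : ℕ, 1 ≤ n → n ≤ p ^ l → n.Coprime p → C.higherCentralCharge n = 1) :
    C.AdmitsGappedEdge := by
  classical
  have := Fintype.ofFinite A
  obtain ⟨L, hL, hmax⟩ : ∃ L : AddSubgroup A, (∀ a ∈ L, C.θ a = 1) ∧
      ∀ M : AddSubgroup A, (∀ a ∈ M, C.θ a = 1) → L ≤ M → M = L := by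
    obtain ⟨L, hL⟩ := (Set.toFinite {L : AddSubgroup A | ∀ a ∈ L, C.θ a = 1}).exists_maximal
      ⟨⊥, fun a ha => by rw [AddSubgroup.mem_bot.1 ha, θ_zero]⟩
    exact ⟨L, hL.prop, fun M hM hLM => le_antisymm (hL.le_of_ge hM hLM) hLM⟩
  -- Adjoining to `L` a boson of `L^⊥` gives a group of bosons.
  have hbos : ∀ a ∈ C.perp L, C.θ a = 1 → a ∈ L := by
    intro a ha hθa
    rw [← hmax (L ⊔ AddSubgroup.zmultiples a) ?_ le_sup_left]
    · exact AddSubgroup.mem_sup_right (AddSubgroup.mem_zmultiples a)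
    · intro x hx
      obtain ⟨y, hy, z, hz, rfl⟩ := AddSubgroup.mem_sup.1 hx
      obtain ⟨k, rfl⟩ := mem_multiples_iff_mem_zmultiples.2 hz
      change C.θ (y + k • a) = 1
      rw [θ_add, hL y hy, θ_nsmul, hθa, braiding_nsmul_right, braiding_comm, ha y hy]
      simp
  have hLperp : L ≤ C.perp L := by
    intro a ha b hb
    have := C.θ_add a b
    rwa [hL _ (add_mem ha hb), hL a ha, hL b hb, one_mul, one_mul, eq_comm] at this
  have hcop : ∀ n : ℕ, n.Coprime p → n.Coprime C.dimSq := fun n hn => by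
    rw [hcard]; exact hn.pow_right k
  set U := {n ∈ Finset.range (p ^ l) | n.Coprime p} with hU
  have hUpos : 0 < U.card := Finset.card_pos.2 ⟨1, by
    simpa [hU] using Nat.one_lt_pow (by lia) hp.one_lt⟩
  have hsum : ∑ n ∈ U, C.gaussSum n = U.card * (Real.sqrt (Nat.card A) : ℂ) := by
    rw [← nsmul_eq_mul, ← Finset.sum_const]
    refine Finset.sum_congr rfl fun n hn => ?_
    simp only [hU, Finset.mem_filter, Finset.mem_range] at hn
    refine (C.higherCentralCharge_eq_one_iff (hcop n hn.2)).1 (h n ?_ hn.1.le hn.2)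
    refine Nat.pos_of_ne_zero ?_
    rintro rfl
    exact hp.one_lt.ne' (by simpa using hn.2)
  -- The Ramanujan sum of each twist is at most `φ(p ^ l)`, attained by the bosons only.
  have hram : ∀ a : A, (∑ n ∈ U, (C.θ a : ℂ) ^ n).re ≤ if C.θ a = 1 then (U.card : ℝ) else 0 := by
    intro a
    split_ifs with ha
    · simp [ha]
    · obtain ⟨r, hr⟩ := sum_pow_coprime hp hl (z := C.θ a)
        (by have := congrArg (fun z : Circle => (z : ℂ)) (hθ a); simpa using this)
        (fun h => ha (Circle.ext (by simpa using h)))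
      rw [hr]
      simp
  have hle : (U.card : ℝ) * Real.sqrt (Nat.card A) ≤ U.card * Nat.card L := by
    have h1 : ∑ n ∈ U, C.gaussSum n =
        ∑ a with a ∈ C.perp L, ∑ n ∈ U, (C.θ a : ℂ) ^ n := by
      rw [Finset.sum_comm]
      refine Finset.sum_congr rfl fun n hn => C.gaussSum_eq_sum_perp L hL (hcop n ?_)
      exact (Finset.mem_filter.1 hn).2
    rw [hsum] at h1
    have h2 := congrArg Complex.re h1
    rw [← Complex.ofReal_natCast, ← Complex.ofReal_mul, Complex.ofReal_re, Complex.re_sum] at h2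
    rw [h2]
    refine (Finset.sum_le_sum fun a _ => hram a).trans ?_
    rw [← Finset.sum_filter, Finset.filter_filter, Finset.sum_const, nsmul_eq_mul, mul_comm]
    gcongr
    rw [Nat.card_eq_fintype_card, Fintype.card_subtype]
    exact Finset.card_le_card fun a ha => by
      simp only [Finset.mem_filter, Finset.mem_univ, true_and] at ha ⊢
      exact hbos a ha.1 ha.2
  have hle' : Real.sqrt (Nat.card A) ≤ Nat.card L :=
    le_of_mul_le_mul_left hle (by exact_mod_cast hUpos)
  have hcardle : Nat.card (C.perp L) ≤ Nat.card L := by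
    have h1 : Nat.card A ≤ Nat.card L * Nat.card L := by
      rw [Real.sqrt_le_left (by positivity), sq] at hle'
      exact_mod_cast hle'
    rw [← C.card_mul_card_perp L] at h1
    exact Nat.le_of_mul_le_mul_left h1 Nat.card_pos
  refine ⟨L, hL, fun a ha => ?_⟩
  rw [AddSubgroup.eq_of_le_of_card_ge hLperp hcardle]
  exact ha

end Basic

/-! ### Primary decomposition -/

section Primary

variable {A : Type*} [AddCommGroup A]

theorem exists_primaryIdem (N p : ℕ) [hp : Fact p.Prime] (hN : N ≠ 0) :
    ∃ e : ℕ, e ≡ 1 [MOD ordProj[p] N] ∧ e ≡ 0 [MOD ordCompl[p] N] := by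
  have hcop : Nat.Coprime (ordProj[p] N) (ordCompl[p] N) :=
    Nat.Coprime.pow_left _ (Nat.coprime_ordCompl hp.out hN)
  obtain ⟨e, he1, he2⟩ := Nat.chineseRemainder hcop 1 0
  exact ⟨e, he1, he2⟩

/-- A natural number whose multiplication map is the projection of a finite abelian group `A` to
its `p`-primary component. -/
def primaryIdem (A : Type*) [Finite A] [Nonempty A] (p : ℕ) [Fact p.Prime] : ℕ :=
  (exists_primaryIdem (Nat.card A) p Nat.card_pos.ne').choose

variable [Finite A]

theorem primaryIdem_spec (p : ℕ) [Fact p.Prime] :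
    primaryIdem A p ≡ 1 [MOD ordProj[p] (Nat.card A)] ∧
      primaryIdem A p ≡ 0 [MOD ordCompl[p] (Nat.card A)] :=
  (exists_primaryIdem (Nat.card A) p Nat.card_pos.ne').choose_spec

theorem ordProj_nsmul_of_mem {p : ℕ} [hp : Fact p.Prime] {a : A}
    (ha : a ∈ AddCommGroup.primaryComponent A p) : ordProj[p] (Nat.card A) • a = 0 := by
  obtain ⟨k, hk⟩ := ha
  obtain ⟨j, -, hj⟩ := (Nat.dvd_prime_pow hp.out).1 (addOrderOf_dvd_of_nsmul_eq_zero hk)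
  rw [← addOrderOf_dvd_iff_nsmul_eq_zero, hj]
  refine pow_dvd_pow _ ?_
  rw [← hp.out.pow_dvd_iff_le_factorization Nat.card_pos.ne', ← hj]
  exact addOrderOf_dvd_natCard a

theorem primaryIdem_nsmul_mem (p : ℕ) [Fact p.Prime] (a : A) :
    primaryIdem A p • a ∈ AddCommGroup.primaryComponent A p := by
  have hz : p ^ ((Nat.card A).factorization p) • (primaryIdem A p • a) = 0 := by
    obtain ⟨d, hd⟩ := Nat.modEq_zero_iff_dvd.1 (primaryIdem_spec (A := A) p).2
    rw [hd, ← mul_nsmul', ← mul_assoc, Nat.ordProj_mul_ordCompl_eq_self, mul_nsmul]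
    simp
  exact ⟨_, hz⟩

theorem primaryIdem_nsmul_of_mem {p : ℕ} [Fact p.Prime] {a : A}
    (ha : a ∈ AddCommGroup.primaryComponent A p) : primaryIdem A p • a = a := by
  have := (nsmul_eq_nsmul_iff_modEq (x := a) (n := primaryIdem A p) (m := 1)).2
    ((primaryIdem_spec p).1.of_dvd (addOrderOf_dvd_of_nsmul_eq_zero (ordProj_nsmul_of_mem ha)))
  simpa using this

theorem primaryIdem_nsmul_of_mem_of_ne {p q : ℕ} [hp : Fact p.Prime] [hq : Fact q.Prime]
    (hpq : p ≠ q) {a : A} (ha : a ∈ AddCommGroup.primaryComponent A q) :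
    primaryIdem A p • a = 0 := by
  have h1 : addOrderOf a ∣ ordProj[p] (Nat.card A) * ordCompl[p] (Nat.card A) := by
    rw [Nat.ordProj_mul_ordCompl_eq_self]
    exact addOrderOf_dvd_natCard a
  obtain ⟨k, hk⟩ := ha
  have h2 : (addOrderOf a).Coprime (ordProj[p] (Nat.card A)) :=
    Nat.Coprime.of_dvd_left (addOrderOf_dvd_of_nsmul_eq_zero hk)
      (Nat.Coprime.pow _ _ ((Nat.coprime_primes hq.out hp.out).2 hpq.symm))
  rw [← addOrderOf_dvd_iff_nsmul_eq_zero]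
  exact (h2.dvd_of_dvd_mul_left h1).trans (Nat.modEq_zero_iff_dvd.1 (primaryIdem_spec p).2)

/-- The projections of an element of a finite abelian group to the primary components. -/
def toPrimary (A : Type*) [AddCommGroup A] [Finite A] :
    A →+ ∀ p : (Nat.card A).primeFactors, AddCommGroup.primaryComponent A (p : ℕ) where
  toFun a p := ⟨primaryIdem A (p : ℕ) • a, primaryIdem_nsmul_mem _ a⟩
  map_zero' := by ext; simp
  map_add' a b := by ext; simp

theorem toPrimary_sum (x : ∀ p : (Nat.card A).primeFactors,
    AddCommGroup.primaryComponent A (p : ℕ)) : toPrimary A (∑ p, (x p : A)) = x := by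
  funext q
  apply Subtype.ext
  change primaryIdem A (q : ℕ) • _ = _
  rw [Finset.smul_sum, Finset.sum_eq_single q]
  · exact primaryIdem_nsmul_of_mem (x q).2
  · intro p _ hpq
    exact primaryIdem_nsmul_of_mem_of_ne (fun h => hpq (Subtype.ext h.symm)) (x p).2
  · simp

/-- An element killed by all the projections is `0`: a prime dividing its order would divide the
corresponding idempotent, which is `1` modulo that prime. -/
theorem toPrimary_injective : Function.Injective (toPrimary A) := by
  rw [injective_iff_map_eq_zero]
  intro a ha
  by_contra hne
  obtain ⟨p, hp, hpa⟩ := Nat.exists_prime_and_dvd (mt AddMonoid.addOrderOf_eq_one_iff.1 hne)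
  have hpN : p ∣ Nat.card A := hpa.trans (addOrderOf_dvd_natCard a)
  have : Fact p.Prime := ⟨hp⟩
  have h0 : primaryIdem A p • a = 0 := congrArg Subtype.val
    (congrFun ha ⟨p, Nat.mem_primeFactors.2 ⟨hp, hpN, Nat.card_pos.ne'⟩⟩)
  have h1 : p ∣ primaryIdem A p := hpa.trans (addOrderOf_dvd_iff_nsmul_eq_zero.2 h0)
  have h2 : primaryIdem A p ≡ 1 [MOD p] :=
    (primaryIdem_spec (A := A) p).1.of_dvd
      (dvd_pow_self p (hp.factorization_pos_of_dvd Nat.card_pos.ne' hpN).ne')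
  exact hp.one_lt.ne' (Nat.dvd_one.1 ((h2.dvd_iff dvd_rfl).1 h1))

/-- The primary decomposition of a finite abelian group. -/
def primaryEquiv (A : Type*) [AddCommGroup A] [Finite A] :
    A ≃+ ∀ p : (Nat.card A).primeFactors, AddCommGroup.primaryComponent A (p : ℕ) :=
  AddEquiv.ofBijective (toPrimary A) ⟨toPrimary_injective, fun x => ⟨_, toPrimary_sum x⟩⟩

theorem sum_primaryEquiv (a : A) : ∑ p, (primaryEquiv A a p : A) = a :=
  toPrimary_injective (toPrimary_sum (primaryEquiv A a))

theorem exists_card_primaryComponent (p : ℕ) [hp : Fact p.Prime] :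
    ∃ k, Nat.card (AddCommGroup.primaryComponent A p) = p ^ k := by
  have h : IsPGroup p (Multiplicative (AddCommGroup.primaryComponent A p)) := by
    intro a
    obtain ⟨k, hk⟩ := a.toAdd.2
    exact ⟨k, Multiplicative.toAdd.injective (Subtype.ext hk)⟩
  obtain ⟨k, hk⟩ := IsPGroup.iff_card.1 h
  exact ⟨k, by rw [← hk, Nat.card_congr Multiplicative.toAdd]⟩

theorem card_primaryComponent (p : (Nat.card A).primeFactors) :
    Nat.card (AddCommGroup.primaryComponent A (p : ℕ)) =
      (p : ℕ) ^ (Nat.card A).factorization p := by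
  choose k hk using fun p : (Nat.card A).primeFactors =>
    exists_card_primaryComponent (A := A) (p : ℕ)
  have h := Nat.card_congr (primaryEquiv A).toEquiv
  rw [Nat.card_pi] at h
  simp_rw [hk] at h
  have hf := congrArg (fun N => N.factorization (p : ℕ)) h
  rw [Nat.factorization_prod (fun q _ => pow_ne_zero _ (Nat.prime_of_mem_primeFactors q.2).ne_zero),
    Finsupp.finsetSum_apply, Finset.sum_eq_single p] at hf
  · rw [hf, (Nat.prime_of_mem_primeFactors p.2).factorization_pow, Finsupp.single_eq_same, hk]
  · intro q _ hqp
    rw [(Nat.prime_of_mem_primeFactors q.2).factorization_pow, Finsupp.single_eq_of_ne]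
    exact fun h => hqp (Subtype.ext h.symm)
  · simp

variable (C : AbelianTQFT A)

theorem braiding_eq_one_of_ne {p q : ℕ} [Fact p.Prime] [Fact q.Prime] (hpq : p ≠ q) {a b : A}
    (ha : a ∈ AddCommGroup.primaryComponent A p) (hb : b ∈ AddCommGroup.primaryComponent A q) :
    C.braiding a b = 1 := by
  rw [← primaryIdem_nsmul_of_mem ha, braiding_nsmul_left', ← braiding_nsmul_right,
    primaryIdem_nsmul_of_mem_of_ne hpq hb, braiding_zero_right]

theorem θ_sum_primary (x : ∀ p : (Nat.card A).primeFactors,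
    AddCommGroup.primaryComponent A (p : ℕ)) (s : Finset (Nat.card A).primeFactors) :
    C.θ (∑ p ∈ s, (x p : A)) = ∏ p ∈ s, C.θ (x p) := by
  classical
  induction s using Finset.induction_on with
  | empty => simp [θ_zero]
  | insert q s hq ih =>
    have hb : ∀ t : Finset (Nat.card A).primeFactors, q ∉ t →
        C.braiding (x q) (∑ p ∈ t, (x p : A)) = 1 := by
      intro t
      induction t using Finset.induction_on with
      | empty => simp [braiding_zero_right]
      | insert r t hr iht =>
        intro hqt
        rw [Finset.mem_insert, not_or] at hqt
        rw [Finset.sum_insert hr, braiding_add_right, iht hqt.2, mul_one]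
        exact C.braiding_eq_one_of_ne (fun h => hqt.1 (Subtype.ext h)) (x q).2 (x r).2
    rw [Finset.sum_insert hq, Finset.prod_insert hq, θ_add, ih, hb s hq, mul_one]

theorem θ_eq_prod_primary (a : A) : C.θ a = ∏ p, C.θ (primaryEquiv A a p) := by
  rw [← θ_sum_primary, sum_primaryEquiv]

theorem equivalent_deligneProduct : C.Equivalent (deligneProduct
    fun p : C.dimSq.primeFactors => C.primary (p : ℕ)) :=
  ⟨primaryEquiv A, fun a => (C.θ_eq_prod_primary a).symm⟩

theorem dimSq_primary (p : C.dimSq.primeFactors) :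
    (C.primary (p : ℕ)).dimSq = (p : ℕ) ^ C.kExp p :=
  card_primaryComponent p

theorem kExp_pos (p : C.dimSq.primeFactors) : 0 < C.kExp p :=
  (Nat.prime_of_mem_primeFactors p.2).factorization_pos_of_dvd C.dimSq_pos.ne'
    (Nat.dvd_of_mem_primeFactors p.2)

theorem gaussSum_eq_prod (n : ℕ) :
    C.gaussSum n = ∏ p : C.dimSq.primeFactors, (C.primary (p : ℕ)).gaussSum n := by
  classical
  have := Fintype.ofFinite A
  have := fun p : (Nat.card A).primeFactors =>
    Fintype.ofFinite (AddCommGroup.primaryComponent A (p : ℕ))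
  have h1 : ∏ p : (Nat.card A).primeFactors, (C.primary (p : ℕ)).gaussSum n =
      ∏ p : (Nat.card A).primeFactors,
        ∑ x : AddCommGroup.primaryComponent A (p : ℕ), (C.θ x : ℂ) ^ n :=
    Finset.prod_congr rfl fun p _ => gaussSum_eq_sum _ n
  refine Eq.trans ?_ h1.symm
  rw [gaussSum_eq_sum, Finset.prod_univ_sum, Fintype.piFinset_univ,
    ← Equiv.sum_comp (primaryEquiv A).toEquiv]
  refine Finset.sum_congr rfl fun a _ => ?_
  rw [Finset.prod_pow, θ_eq_prod_primary]
  congr 1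
  exact map_prod Circle.coeHom _ _

/-- The extra factor of `2` in `k̃` is needed because the braiding determines the squares of the
twists only; at odd primes the order of a twist divides the order of the anyon. -/
theorem fsExponent_primary_dvd (p : C.dimSq.primeFactors) :
    (C.primary (p : ℕ)).fsExponent ∣ (p : ℕ) ^ C.kTilde p := by
  have hp := Nat.prime_of_mem_primeFactors p.2
  rw [kTilde]
  split_ifs with h2
  · rw [pow_succ', ← C.dimSq_primary]
    exact (fsExponent_dvd_two_mul _).trans (Nat.mul_dvd_mul_right (dvd_of_eq h2.symm) _)
  · rw [← C.dimSq_primary]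
    refine fsExponent_dvd_of_odd _ ?_
    rw [C.dimSq_primary]
    exact (hp.odd_of_ne_two h2).pow

theorem exists_fsExponent_primary (p : C.dimSq.primeFactors) :
    ∃ l : ℕ, 1 ≤ l ∧ l ≤ C.kTilde p ∧ (C.primary (p : ℕ)).fsExponent = (p : ℕ) ^ l := by
  have hp := Nat.prime_of_mem_primeFactors p.2
  obtain ⟨l, hl, h⟩ := (Nat.dvd_prime_pow hp).1 (C.fsExponent_primary_dvd p)
  refine ⟨l, Nat.one_le_iff_ne_zero.2 ?_, hl, h⟩
  rintro rfl
  -- If all twists are trivial then so is the braiding, and the factor has a single anyon.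
  have hθ : ∀ a, (C.primary (p : ℕ)).θ a = 1 := by
    have := (C.primary (p : ℕ)).fsExponent_mem.2
    simpa [h] using this
  have hsub : Subsingleton (AddCommGroup.primaryComponent A (p : ℕ)) :=
    ⟨fun a b => by
      rw [(C.primary (p : ℕ)).nondegenerate a, (C.primary (p : ℕ)).nondegenerate b] <;>
      simp [braidingPhase, hθ]⟩
  have h1 := C.dimSq_primary p
  rw [dimSq, Nat.card_of_subsingleton 0] at h1
  exact (Nat.one_lt_pow (C.kExp_pos p).ne' hp.one_lt).ne h1

theorem fsExponent_eq_prod :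
    C.fsExponent = ∏ p : C.dimSq.primeFactors, (C.primary (p : ℕ)).fsExponent := by
  apply Nat.dvd_antisymm
  · rw [fsExponent_dvd_iff]
    intro a
    rw [θ_eq_prod_primary, ← Finset.prod_pow]
    refine Finset.prod_eq_one fun p _ => ?_
    exact (C.primary (p : ℕ)).fsExponent_dvd_iff.1 (Finset.dvd_prod_of_mem
      (fun p : C.dimSq.primeFactors => (C.primary (p : ℕ)).fsExponent) (Finset.mem_univ p))
      (primaryEquiv A a p)
  · refine Finset.prod_dvd_of_isRelPrime (fun p _ q _ hpq => ?_) fun p _ => ?_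
    · obtain ⟨l, -, -, hl⟩ := C.exists_fsExponent_primary p
      obtain ⟨l', -, -, hl'⟩ := C.exists_fsExponent_primary q
      simp only [Function.onFun, hl, hl']
      rw [← Nat.coprime_iff_isRelPrime]
      refine Nat.Coprime.pow _ _ ((Nat.coprime_primes (Nat.prime_of_mem_primeFactors p.2)
        (Nat.prime_of_mem_primeFactors q.2)).2 fun h => hpq (Subtype.ext h))
    · exact (C.primary (p : ℕ)).fsExponent_dvd_iff.2 fun a => C.fsExponent_mem.2 a

/-- A Lagrangian subgroup is the direct sum of its primary components, and these are Lagrangian in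
the primary factors. -/
theorem admitsGappedEdge_iff_primary : C.AdmitsGappedEdge ↔
    ∀ p : C.dimSq.primeFactors, (C.primary (p : ℕ)).AdmitsGappedEdge := by
  constructor
  · rintro ⟨L, hL, hL'⟩ p
    refine ⟨L.comap (AddSubgroup.subtype _), fun a ha => hL a ha, fun a ha => hL' a fun b hb => ?_⟩
    rw [← primaryIdem_nsmul_of_mem a.2, braiding_nsmul_left', ← braiding_nsmul_right]
    exact ha ⟨_, primaryIdem_nsmul_mem _ b⟩ (L.nsmul_mem hb _)
  · intro h
    choose L hL hL' using h
    refine ⟨(AddSubgroup.pi Set.univ L).comap (primaryEquiv A).toAddMonoidHom,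
      fun a ha => ?_, fun a ha p _ => hL' p _ fun b hb => ?_⟩
    · rw [θ_eq_prod_primary]
      exact Finset.prod_eq_one fun p _ => hL p _ (ha p trivial)
    · change C.braiding (primaryIdem A (p : ℕ) • a) b = 1
      rw [braiding_nsmul_left', ← braiding_nsmul_right,
        primaryIdem_nsmul_of_mem b.2]
      refine ha b fun q _ => ?_
      by_cases hqp : q = p
      · subst hqp
        have : (primaryEquiv A) (b : A) q = b := Subtype.ext (primaryIdem_nsmul_of_mem b.2)
        change (primaryEquiv A) (b : A) q ∈ L q
        rwa [this]
      · have : (primaryEquiv A) (b : A) q = 0 := Subtype.ext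
          (primaryIdem_nsmul_of_mem_of_ne (fun h => hqp (Subtype.ext h)) b.2)
        change (primaryEquiv A) (b : A) q ∈ L q
        rw [this]
        exact zero_mem _

theorem coprime_dimSq_primary (p : C.dimSq.primeFactors) {n : ℕ} (hn : n.Coprime p) :
    n.Coprime (C.primary (p : ℕ)).dimSq := by
  rw [dimSq_primary]
  exact hn.pow_right _

theorem admitsGappedEdge_primary_iff (p : C.dimSq.primeFactors) :
    (C.primary (p : ℕ)).AdmitsGappedEdge ↔
      ∀ n : ℕ, 1 ≤ n → n ≤ (C.primary (p : ℕ)).fsExponent → n.Coprime p →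
        (C.primary (p : ℕ)).higherCentralCharge n = 1 := by
  refine ⟨fun h n _ _ hn => higherCentralCharge_eq_one _ (C.coprime_dimSq_primary p hn) h,
    fun h => ?_⟩
  obtain ⟨l, hl, -, hN⟩ := C.exists_fsExponent_primary p
  rw [hN] at h
  exact admitsGappedEdge_of_higherCentralCharge _ (Nat.prime_of_mem_primeFactors p.2) hl
    (C.dimSq_primary p) (hN ▸ (C.primary (p : ℕ)).fsExponent_mem.2) h

/-! ### Gauss sums of the whole theory at multiples of the rotation unit -/

omit [Finite A] in
theorem rotationUnit_mul_pow_kTilde (p : C.dimSq.primeFactors) :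
    C.rotationUnit p * (p : ℕ) ^ C.kTilde p = 2 * C.dimSq := by
  refine Nat.div_mul_cancel ?_
  have h : (p : ℕ) ^ C.kExp p ∣ C.dimSq := Nat.ordProj_dvd _ _
  rw [kTilde]
  split_ifs with h2
  · rw [pow_succ']
    conv_lhs => rw [h2]
    rw [h2] at h
    exact Nat.mul_dvd_mul_left 2 h
  · exact h.mul_left 2

theorem rotationUnit_coprime (p : C.dimSq.primeFactors) : (C.rotationUnit p).Coprime p := by
  have hp := Nat.prime_of_mem_primeFactors p.2
  rw [Nat.coprime_comm, hp.coprime_iff_not_dvd]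
  intro hdvd
  have h1 : (p : ℕ) ^ (C.kTilde p + 1) ∣ 2 * C.dimSq := by
    rw [← C.rotationUnit_mul_pow_kTilde p, pow_succ']
    exact Nat.mul_dvd_mul_right hdvd _
  have h2 : ¬ (p : ℕ) ^ (C.kExp p + 1) ∣ C.dimSq :=
    Nat.pow_succ_factorization_not_dvd C.dimSq_pos.ne' hp
  rw [kTilde] at h1
  split_ifs at h1 with h
  · rw [pow_succ', h] at h1
    rw [h] at h2
    exact h2 (Nat.dvd_of_mul_dvd_mul_left two_pos h1)
  · refine h2 (Nat.Coprime.dvd_of_dvd_mul_left (Nat.Coprime.pow_left _ ?_) h1)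
    exact (Nat.coprime_primes hp Nat.prime_two).2 h

/-- At multiples of the rotation unit of `p`, the twists of the other primary factors disappear. -/
theorem fsExponent_primary_dvd_rotationUnit {p q : C.dimSq.primeFactors} (hqp : q ≠ p) :
    (C.primary (q : ℕ)).fsExponent ∣ C.rotationUnit p := by
  have h1 : (C.primary (q : ℕ)).fsExponent ∣ C.rotationUnit p * (p : ℕ) ^ C.kTilde p := by
    rw [C.rotationUnit_mul_pow_kTilde p]
    exact ((C.primary (q : ℕ)).fsExponent_dvd_iff.2 fun a => C.fsExponent_mem.2 a).trans
      C.fsExponent_dvd_two_mul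
  refine Nat.Coprime.dvd_of_dvd_mul_right ?_ h1
  obtain ⟨l, -, -, hl⟩ := C.exists_fsExponent_primary q
  rw [hl]
  exact Nat.Coprime.pow _ _ ((Nat.coprime_primes (Nat.prime_of_mem_primeFactors q.2)
    (Nat.prime_of_mem_primeFactors p.2)).2 fun h => hqp (Subtype.ext h))

theorem gaussSum_of_fsExponent_dvd {n : ℕ} (h : C.fsExponent ∣ n) :
    C.gaussSum n = C.dimSq := by
  have := Fintype.ofFinite A
  have h1 : ∀ a, (C.θ a : ℂ) ^ n = 1 := fun a => by
    have := congrArg (fun z : Circle => (z : ℂ)) (C.fsExponent_dvd_iff.1 h a)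
    simpa using this
  simp [gaussSum_eq_sum, h1, dimSq, Nat.card_eq_fintype_card]

theorem coprime_mul_rotationUnit (p : C.dimSq.primeFactors) {m : ℕ} (hm : m.Coprime p) :
    (m * C.rotationUnit p).Coprime (C.primary (p : ℕ)).dimSq :=
  C.coprime_dimSq_primary p (hm.mul_left (C.rotationUnit_coprime p))

theorem exists_gaussSum_rotationUnit (p : C.dimSq.primeFactors) {m : ℕ} (hm : m.Coprime p) :
    ∃ r : ℝ, 0 < r ∧ C.gaussSum (m * C.rotationUnit p) =
      r * (C.primary (p : ℕ)).higherCentralCharge (m * C.rotationUnit p) := by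
  classical
  have hne := gaussSum_ne_zero _ (C.coprime_mul_rotationUnit p hm)
  have hne' : (‖(C.primary (p : ℕ)).gaussSum (m * C.rotationUnit p)‖ : ℂ) ≠ 0 := by simpa using hne
  refine ⟨‖(C.primary (p : ℕ)).gaussSum (m * C.rotationUnit p)‖ *
    ∏ q ∈ Finset.univ.erase p, ((C.primary (q : ℕ)).dimSq : ℝ), ?_, ?_⟩
  · exact mul_pos (norm_pos_iff.2 hne)
      (Finset.prod_pos fun q _ => by exact_mod_cast (C.primary (q : ℕ)).dimSq_pos)
  · rw [gaussSum_eq_prod, ← Finset.mul_prod_erase _ _ (Finset.mem_univ p), higherCentralCharge,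
      Finset.prod_congr rfl fun q hq => gaussSum_of_fsExponent_dvd _ <|
        (C.fsExponent_primary_dvd_rotationUnit (Finset.ne_of_mem_erase hq)).mul_left m]
    push_cast
    field_simp

theorem higherCentralCharge_congr {n n' : ℕ} (h : n ≡ n' [MOD C.fsExponent]) :
    C.higherCentralCharge n = C.higherCentralCharge n' := by
  have : C.gaussSum n = C.gaussSum n' := by
    refine finsum_congr fun a => ?_
    have h1 := (pow_eq_pow_iff_modEq (x := C.θ a)).2
      (h.of_dvd (orderOf_dvd_of_pow_eq_one (C.fsExponent_mem.2 a)))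
    have := congrArg (fun z : Circle => (z : ℂ)) h1
    simpa using this
  simp [higherCentralCharge, this]

/-- The rotation unit of `p` is invertible modulo `p ^ k̃`, hence modulo the Frobenius–Schur
exponent of the factor at `p`. -/
theorem exists_mul_rotationUnit_modEq (p : C.dimSq.primeFactors) {n : ℕ} (hn : n.Coprime p) :
    ∃ m : ℕ, 1 ≤ m ∧ m ≤ (p : ℕ) ^ C.kTilde p ∧ m.Coprime p ∧
      m * C.rotationUnit p ≡ n [MOD (C.primary (p : ℕ)).fsExponent] := by
  have hp := Nat.prime_of_mem_primeFactors p.2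
  obtain ⟨l, hl, hlk, hN⟩ := C.exists_fsExponent_primary p
  have hpos : 0 < C.kTilde p := by lia
  have hone : 1 < (p : ℕ) ^ C.kTilde p := Nat.one_lt_pow hpos.ne' hp.one_lt
  obtain ⟨u, hu⟩ := Nat.exists_mul_mod_eq_one_of_coprime
    ((C.rotationUnit_coprime p).pow_right (C.kTilde p)) hone
  have hu1 : C.rotationUnit p * u ≡ 1 [MOD (p : ℕ) ^ C.kTilde p] := by
    rw [Nat.ModEq, hu.2, Nat.mod_eq_of_lt hone]
  have hmod : (n * u % (p : ℕ) ^ C.kTilde p) * C.rotationUnit p ≡ n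
      [MOD (p : ℕ) ^ C.kTilde p] := by
    calc _ ≡ n * u * C.rotationUnit p [MOD (p : ℕ) ^ C.kTilde p] :=
          (Nat.mod_modEq _ _).mul_right _
      _ = n * (C.rotationUnit p * u) := by ring
      _ ≡ n * 1 [MOD (p : ℕ) ^ C.kTilde p] := hu1.mul_left _
      _ = n := mul_one n
  have hcop : (n * u % (p : ℕ) ^ C.kTilde p).Coprime p := by
    have h1 := (hmod.of_dvd (dvd_pow_self (p : ℕ) hpos.ne')).gcd_eq
    exact Nat.Coprime.coprime_mul_right (h1.trans hn)
  refine ⟨n * u % (p : ℕ) ^ C.kTilde p, Nat.pos_of_ne_zero fun h0 => ?_,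
    (Nat.mod_lt _ (by lia)).le, hcop, hmod.of_dvd (C.fsExponent_primary_dvd p)⟩
  rw [h0, Nat.coprime_zero_left] at hcop
  exact hp.one_lt.ne' hcop

/-- The gapped-edge condition is decided by the higher central charges of the primary factors at
the multiples of the rotation units. -/
theorem admitsGappedEdge_iff_rotationUnit : C.AdmitsGappedEdge ↔
    ∀ p : C.dimSq.primeFactors, ∀ m : ℕ, 1 ≤ m → m ≤ (p : ℕ) ^ C.kTilde p → m.Coprime p →
      (C.primary (p : ℕ)).higherCentralCharge (m * C.rotationUnit p) = 1 := by
  rw [admitsGappedEdge_iff_primary]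
  refine forall_congr' fun p => ⟨fun h m _ _ hm =>
    higherCentralCharge_eq_one _ (C.coprime_mul_rotationUnit p hm) h, fun h => ?_⟩
  rw [C.admitsGappedEdge_primary_iff p]
  intro n _ _ hn
  obtain ⟨m, h1, h2, h3, h4⟩ := C.exists_mul_rotationUnit_modEq p hn
  rw [← higherCentralCharge_congr _ h4]
  exact h m h1 h2 h3

theorem higherCentralCharge_rotationUnit (p : C.dimSq.primeFactors) {m : ℕ} (hm : m.Coprime p) :
    C.gaussSum (m * C.rotationUnit p) ≠ 0 ∧ C.higherCentralCharge (m * C.rotationUnit p) =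
      (C.primary (p : ℕ)).higherCentralCharge (m * C.rotationUnit p) := by
  have hne := gaussSum_ne_zero _ (C.coprime_mul_rotationUnit p hm)
  obtain ⟨r, hr, h⟩ := C.exists_gaussSum_rotationUnit p hm
  have hn : ‖(C.primary (p : ℕ)).higherCentralCharge (m * C.rotationUnit p)‖ = 1 := by
    simp [higherCentralCharge, hne]
  refine ⟨?_, ?_⟩
  · rw [h]
    refine mul_ne_zero (by exact_mod_cast hr.ne') ?_
    rw [← norm_pos_iff, hn]
    exact one_pos
  · rw [higherCentralCharge, h, norm_mul, hn, mul_one, Complex.norm_real, Real.norm_of_nonneg hr.le,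
      mul_div_cancel_left₀ _ (by exact_mod_cast hr.ne')]

end Primary

end AbelianTQFT

/-! ### Characters of edge theories -/

namespace EdgeSpectrum

variable {A : Type*} [AddCommGroup A] (E : EdgeSpectrum A)

/-- The contribution of a state to a character at `τ = x + iy`, without the Casimir factor. -/
def stateWeight (x y : ℝ) (s : E.State) : ℂ :=
  Complex.exp (2 * Real.pi * Complex.I * x * ((E.h s - E.hbar s : ℝ) : ℂ)) *
    (Real.exp (-(2 * Real.pi * y * (E.h s + E.hbar s))) : ℂ)

/-- A character at `τ = x + iy`, without the Casimir factor. -/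
def reducedCharacter (a : A) (x y : ℝ) : ℂ :=
  ∑' s : {s : E.State // E.sector s = a}, E.stateWeight x y s

theorem norm_stateWeight (x y : ℝ) (s : E.State) :
    ‖E.stateWeight x y s‖ = Real.exp (-(2 * Real.pi * y * (E.h s + E.hbar s))) := by
  have : 2 * Real.pi * Complex.I * x * ((E.h s - E.hbar s : ℝ) : ℂ) =
      ((2 * Real.pi * x * (E.h s - E.hbar s) : ℝ) : ℂ) * Complex.I := by
    push_cast; ring
  rw [stateWeight, norm_mul, this, Complex.norm_exp_ofReal_mul_I, one_mul, Complex.norm_real,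
    Real.norm_of_nonneg (Real.exp_pos _).le]

theorem summable_subtype (a : A) {y : ℝ} (hy : 0 < y) :
    Summable fun s : {s : E.State // E.sector s = a} =>
      Real.exp (-(2 * Real.pi * y * (E.h s + E.hbar s))) :=
  (E.summable y hy).comp_injective Subtype.val_injective

/-- The Casimir factor `q ^ (-c/24) q̄ ^ (-c̄/24)` splits off from a character; its phase involves
`c - c̄` only, and its modulus `c + c̄` only. -/
theorem character_eq (a : A) (x y : ℝ) :
    E.character a (x + Complex.I * y) =
      (Real.exp (2 * Real.pi * y * ((E.c + E.cbar) / 24)) : ℂ) *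
      Complex.exp (-(2 * Real.pi * Complex.I * x * ((E.c - E.cbar : ℝ) : ℂ) / 24)) *
      E.reducedCharacter a x y := by
  rw [character, reducedCharacter, ← tsum_mul_left]
  refine tsum_congr fun s => ?_
  simp only [stateWeight, Complex.ofReal_exp, ← Complex.exp_add, map_add, map_mul,
    Complex.conj_ofReal, Complex.conj_I]
  congr 1
  push_cast
  ring_nf
  simp only [Complex.I_sq]
  ring

/-- As `y → ∞` only the vacuum survives: the other states have positive energy, and the thermal
sums are dominated by the one at `y = 1`. -/
theorem tendsto_reducedCharacter [DecidableEq A] (a : A) (x : ℝ) :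
    Tendsto (fun y => E.reducedCharacter a x y) atTop (𝓝 (if a = 0 then 1 else 0)) := by
  classical
  have hlim : ∑' s : {s : E.State // E.sector s = a}, (if s.1 = E.vac then (1 : ℂ) else 0) =
      if a = 0 then 1 else 0 := by
    split_ifs with ha
    · subst ha
      rw [tsum_eq_single ⟨E.vac, E.sector_vac⟩]
      · simp
      · intro s hs
        rw [if_neg fun h => hs (Subtype.ext h)]
    · have h0 : ∀ s : {s : E.State // E.sector s = a},
          (if s.1 = E.vac then (1 : ℂ) else 0) = 0 :=
        fun s => if_neg fun h => ha (by rw [← s.2, h, E.sector_vac])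
      simp_rw [h0, tsum_zero]
  rw [← hlim]
  refine tendsto_tsum_of_dominated_convergence (E.summable_subtype a one_pos) (fun s => ?_) ?_
  · split_ifs with hs
    · simp [stateWeight, hs, E.h_vac, E.hbar_vac]
    · have hpos : 0 < E.h s + E.hbar s := by
        have h1 := E.h_nonneg s
        have h2 := E.hbar_nonneg s
        refine lt_of_le_of_ne (by positivity) fun h => hs (E.vac_unique s ?_ ?_) <;> linarith
      rw [tendsto_zero_iff_norm_tendsto_zero]
      simp_rw [norm_stateWeight]
      refine Real.tendsto_exp_neg_atTop_nhds_zero.comp ?_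
      exact ((tendsto_id.const_mul_atTop Real.two_pi_pos).atTop_mul_const hpos)
  · filter_upwards [eventually_ge_atTop 1] with y hy s
    rw [norm_stateWeight]
    have h1 := E.h_nonneg s
    have h2 := E.hbar_nonneg s
    gcongr

/-- The trivial character is positive on the imaginary axis, where it is a thermal partition
function. -/
theorem exists_character_zero_eq {y : ℝ} (hy : 0 < y) :
    ∃ r : ℝ, 0 < r ∧ E.character 0 (Complex.I * y) = r := by
  refine ⟨Real.exp (2 * Real.pi * y * ((E.c + E.cbar) / 24)) *
    ∑' s : {s : E.State // E.sector s = 0},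
      Real.exp (-(2 * Real.pi * y * (E.h s + E.hbar s))), mul_pos (Real.exp_pos _) ?_, ?_⟩
  · exact (E.summable_subtype 0 hy).tsum_pos (fun s => (Real.exp_pos _).le)
      ⟨E.vac, E.sector_vac⟩ (Real.exp_pos _)
  · have h := E.character_eq 0 0 y
    simp only [Complex.ofReal_zero, zero_add] at h
    rw [h]
    simp [reducedCharacter, stateWeight, Complex.ofReal_tsum]

end EdgeSpectrum

namespace EdgeCFT

variable {A : Type*} [AddCommGroup A] {C : AbelianTQFT A} (E : EdgeCFT C)

/-- The modular transformation `T ^ n` is diagonal in the sectors. -/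
theorem character_add_natCast (a : A) (τ : ℂ) (n : ℕ) :
    E.character a (τ + n) = (C.θ a : ℂ) ^ n *
      Complex.exp (-(2 * Real.pi * Complex.I * n * (E.chiralCentralCharge : ℂ) / 24)) *
      E.character a τ := by
  rw [EdgeSpectrum.character, EdgeSpectrum.character, ← tsum_mul_left]
  refine tsum_congr fun s => ?_
  have hs := E.spin s
  rw [s.2] at hs
  rw [hs, ← Complex.exp_nat_mul]
  simp only [← Complex.exp_add, map_add, Complex.conj_natCast, chiralCentralCharge]
  congr 1
  push_cast
  ring

theorem modularS_zero_left (a : A) : C.modularS 0 a = 1 / (Real.sqrt C.dimSq : ℂ) := by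
  simp [AbelianTQFT.modularS, C.θ_neg, C.θ_zero]

theorem modularS_zero_right (a : A) : C.modularS a 0 = 1 / (Real.sqrt C.dimSq : ℂ) := by
  simp [AbelianTQFT.modularS, C.θ_zero]

theorem neg_one_div_im_pos {τ : ℂ} (hτ : 0 < τ.im) : 0 < (-1 / τ).im := by
  have h0 : τ ≠ 0 := by rintro rfl; simp at hτ
  rw [neg_div, one_div, Complex.neg_im, Complex.inv_im, neg_div, neg_neg]
  exact div_pos hτ (Complex.normSq_pos.2 h0)

/-- The action of `S T ^ n S` on the trivial character. It maps the cusp `-1/n` to `i∞`. -/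
theorem character_zero_STS [Fintype A] (n : ℕ) {τ : ℂ} (hτ : 0 < τ.im) :
    E.character 0 (-1 / (-1 / τ + n)) =
      Complex.exp (-(2 * Real.pi * Complex.I * n * (E.chiralCentralCharge : ℂ) / 24)) *
      ∑ b, (∑ a, (C.θ a : ℂ) ^ n * C.modularS a b / (Real.sqrt C.dimSq : ℂ)) *
        E.character b τ := by
  have him : 0 < (-1 / τ + n).im := by simpa using neg_one_div_im_pos hτ
  rw [E.modular 0 _ him, finsum_eq_sum_of_fintype]
  simp_rw [character_add_natCast, E.modular _ τ hτ, finsum_eq_sum_of_fintype, modularS_zero_left,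
    Finset.mul_sum, Finset.sum_mul, Finset.mul_sum]
  rw [Finset.sum_comm]
  refine Finset.sum_congr rfl fun a _ => Finset.sum_congr rfl fun b _ => ?_
  ring

theorem sum_modularS_zero [Fintype A] (n : ℕ) :
    ∑ a, (C.θ a : ℂ) ^ n * C.modularS a 0 / (Real.sqrt C.dimSq : ℂ) =
      C.gaussSum n / C.dimSq := by
  have h : (Real.sqrt C.dimSq : ℂ) * (Real.sqrt C.dimSq : ℂ) = C.dimSq := by
    rw [← Complex.ofReal_mul, Real.mul_self_sqrt (by positivity), Complex.ofReal_natCast]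
  rw [C.gaussSum_eq_sum, Finset.sum_div, ← h]
  refine Finset.sum_congr rfl fun a _ => ?_
  rw [modularS_zero_right, mul_one_div, div_div]

/-! ### Partial rotations -/

variable [Finite A]

/-- As `v → 0⁺` the point `iv - 1/n` tends to the cusp `-1/n`, where the trivial character has the
phase of the `n`-th Gauss sum. -/
theorem exists_character_near_cusp {n : ℕ} (hn : 1 ≤ n) :
    ∃ g : ℝ → ℂ, Tendsto g (𝓝[>] 0) (𝓝 (C.gaussSum n / C.dimSq)) ∧
      ∀ v : ℝ, 0 < v → ∃ r : ℝ, 0 < r ∧ E.character 0 (Complex.I * v - 1 / n) = r *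
        (Complex.exp (-(2 * Real.pi * Complex.I * (1 / n + n) *
          (E.chiralCentralCharge : ℂ) / 24)) * g v) := by
  classical
  have := Fintype.ofFinite A
  have hn0 : (0 : ℝ) < n := by exact_mod_cast hn
  refine ⟨fun v => ∑ b, (∑ a, (C.θ a : ℂ) ^ n * C.modularS a b / (Real.sqrt C.dimSq : ℂ)) *
    E.reducedCharacter b (1 / n) (1 / (n ^ 2 * v)), ?_, fun v hv => ?_⟩
  · have hlim : C.gaussSum n / C.dimSq =
        ∑ b, (∑ a, (C.θ a : ℂ) ^ n * C.modularS a b / (Real.sqrt C.dimSq : ℂ)) *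
          (if b = 0 then 1 else 0) := by
      simp [← sum_modularS_zero]
    rw [hlim]
    refine tendsto_finsetSum _ fun b _ => Tendsto.const_mul _ ?_
    refine (E.tendsto_reducedCharacter b (1 / n)).comp ?_
    simp_rw [one_div, mul_inv]
    exact tendsto_inv_nhdsGT_zero.const_mul_atTop (by positivity)
  · have hy : 0 < 1 / (n ^ 2 * v) := by positivity
    set y : ℝ := 1 / (n ^ 2 * v) with hydef
    refine ⟨Real.exp (2 * Real.pi * y * ((E.c + E.cbar) / 24)), Real.exp_pos _, ?_⟩
    -- `iv - 1/n` is the image of `1/n + iy` under `S T ^ n S`.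
    have hτ : Complex.I * v - 1 / n =
        -1 / (-1 / (((1 / n : ℝ) : ℂ) + Complex.I * y) + n) := by
      have h1 : (n : ℂ) ≠ 0 := by exact_mod_cast hn0.ne'
      have h2 : (y : ℂ) ≠ 0 := by exact_mod_cast hy.ne'
      have h3 : 1 / (n : ℂ) + Complex.I * y ≠ 0 := by
        intro h
        have := congrArg Complex.im h
        simp only [Complex.add_im, Complex.mul_im, Complex.I_re, Complex.I_im, Complex.ofReal_re,
          Complex.ofReal_im, ← Complex.ofReal_natCast, ← Complex.ofReal_one,
          ← Complex.ofReal_div, Complex.zero_im] at this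
        linarith
      have h4 : (v : ℂ) = 1 / (n ^ 2 * y) := by
        rw [hydef]
        push_cast
        have : (v : ℂ) ≠ 0 := by exact_mod_cast hv.ne'
        field_simp
      have h5 : -1 / (1 / (n : ℂ) + Complex.I * y) + n =
          n * (Complex.I * y) / (1 / (n : ℂ) + Complex.I * y) := by
        rw [div_add' _ _ _ h3]
        congr 1
        field_simp
        ring
      push_cast
      rw [h5, h4, div_div_eq_mul_div]
      field_simp
      linear_combination Complex.I_sq
    rw [hτ, E.character_zero_STS n (by simpa using hy)]
    simp_rw [E.character_eq]
    have hexp : Complex.exp (-(2 * Real.pi * Complex.I * (1 / n + n) *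
        (E.chiralCentralCharge : ℂ) / 24)) =
      Complex.exp (-(2 * Real.pi * Complex.I * n * (E.chiralCentralCharge : ℂ) / 24)) *
      Complex.exp (-(2 * Real.pi * Complex.I * ((1 / n : ℝ) : ℂ) *
        ((E.c - E.cbar : ℝ) : ℂ) / 24)) := by
      rw [← Complex.exp_add, chiralCentralCharge]
      congr 1
      push_cast
      ring
    rw [hexp, Finset.mul_sum, Finset.mul_sum, Finset.mul_sum]
    refine Finset.sum_congr rfl fun b _ => ?_
    ring

omit [Finite A] in
/-- As `u → ∞` the trivial character at `iu + 1/n` is dominated by the vacuum. -/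
theorem exists_character_near_infty (n : ℕ) :
    ∃ g : ℝ → ℂ, Tendsto g atTop (𝓝 1) ∧
      ∀ u : ℝ, ∃ r : ℝ, 0 < r ∧ E.character 0 (Complex.I * u + 1 / n) = r *
        (Complex.exp (-(2 * Real.pi * Complex.I * (1 / n) *
          (E.chiralCentralCharge : ℂ) / 24)) * g u) := by
  classical
  refine ⟨fun u => E.reducedCharacter 0 (1 / n) u, ?_, fun u =>
    ⟨Real.exp (2 * Real.pi * u * ((E.c + E.cbar) / 24)), Real.exp_pos _, ?_⟩⟩
  · simpa using E.tendsto_reducedCharacter 0 (1 / n)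
  · have h := E.character_eq 0 (1 / n) u
    rw [add_comm] at h
    push_cast at h
    rw [h, chiralCentralCharge, mul_assoc]
    push_cast
    rfl

/-- Positive real factors do not affect the limit of the phase. -/
theorem tendsto_div_norm_of_pos_mul {ι : Type*} {l : Filter ι} {f g : ι → ℂ} {w : ℂ}
    (hw : w ≠ 0) (hg : Tendsto g l (𝓝 w))
    (hfg : ∀ᶠ i in l, ∃ r : ℝ, 0 < r ∧ f i = r * g i) :
    Tendsto (fun i => f i / (‖f i‖ : ℂ)) l (𝓝 (w / ‖w‖)) := by
  have h : Tendsto (fun i => g i / (‖g i‖ : ℂ)) l (𝓝 (w / ‖w‖)) :=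
    hg.div ((Complex.continuous_ofReal.tendsto _).comp hg.norm) (by simpa using hw)
  refine h.congr' ?_
  filter_upwards [hfg] with i hi
  obtain ⟨r, hr, hf⟩ := hi
  have hr' : (r : ℂ) ≠ 0 := by exact_mod_cast hr.ne'
  rw [hf, norm_mul, Complex.norm_real, Real.norm_of_nonneg hr.le, Complex.ofReal_mul,
    mul_div_mul_left _ _ hr']

/-- The left factor of the partial rotation contributes the Casimir phase of the vacuum, the right
factor that of `S T ^ n S` at the vacuum; the denominators are positive. -/
theorem hasRotationPhase {n : ℕ} (hn : 1 ≤ n) (hG : C.gaussSum n ≠ 0) :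
    E.HasRotationPhase n (E.chiralPhase n * C.higherCentralCharge n) := by
  obtain ⟨g₁, hg₁, h₁⟩ := E.exists_character_near_infty n
  obtain ⟨g₂, hg₂, h₂⟩ := E.exists_character_near_cusp hn
  have hD : (C.dimSq : ℂ) ≠ 0 := by exact_mod_cast C.dimSq_pos.ne'
  have hchi : ‖E.chiralPhase n‖ = 1 := by
    have : -(2 * Real.pi * Complex.I * (2 / n + n) * (E.chiralCentralCharge : ℂ) / 24) =
        ((-(2 * Real.pi * (2 / n + n) * E.chiralCentralCharge / 24) : ℝ) : ℂ) * Complex.I := by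
      push_cast; ring
    rw [chiralPhase, this, Complex.norm_exp_ofReal_mul_I]
  have hchi0 : E.chiralPhase n ≠ 0 := Complex.exp_ne_zero _
  have hlim : Tendsto (fun x : ℝ × ℝ => E.chiralPhase n * (g₁ x.1 * g₂ x.2))
      (atTop ×ˢ 𝓝[>] (0 : ℝ)) (𝓝 (E.chiralPhase n * (1 * (C.gaussSum n / C.dimSq)))) :=
    ((hg₁.comp tendsto_fst).mul (hg₂.comp tendsto_snd)).const_mul _
  have hw : E.chiralPhase n * (1 * (C.gaussSum n / C.dimSq)) ≠ 0 := by
    rw [one_mul]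
    exact mul_ne_zero hchi0 (div_ne_zero hG hD)
  have hphase : E.chiralPhase n * C.higherCentralCharge n =
      E.chiralPhase n * (1 * (C.gaussSum n / C.dimSq)) /
        (‖E.chiralPhase n * (1 * (C.gaussSum n / C.dimSq))‖ : ℂ) := by
    rw [norm_mul, hchi, one_mul, one_mul, norm_div, Complex.norm_natCast,
      AbelianTQFT.higherCentralCharge]
    have : (‖C.gaussSum n‖ : ℂ) ≠ 0 := by simpa using hG
    push_cast
    field_simp
  rw [hphase]
  refine tendsto_div_norm_of_pos_mul hw hlim ?_
  have hev : ∀ᶠ x : ℝ × ℝ in atTop ×ˢ 𝓝[>] (0 : ℝ), 0 < x.1 ∧ 0 < x.2 :=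
    (eventually_gt_atTop 0).prod_mk self_mem_nhdsWithin
  filter_upwards [hev] with x hx
  obtain ⟨r₁, hr₁, e₁⟩ := h₁ x.1
  obtain ⟨r₂, hr₂, e₂⟩ := h₂ x.2 hx.2
  obtain ⟨r₃, hr₃, e₃⟩ := E.exists_character_zero_eq hx.1
  obtain ⟨r₄, hr₄, e₄⟩ := E.exists_character_zero_eq hx.2
  refine ⟨r₁ * r₂ / (r₃ * r₄), by positivity, ?_⟩
  have hsplit : E.chiralPhase n =
      Complex.exp (-(2 * Real.pi * Complex.I * (1 / n) * (E.chiralCentralCharge : ℂ) / 24)) *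
      Complex.exp (-(2 * Real.pi * Complex.I * (1 / n + n) *
        (E.chiralCentralCharge : ℂ) / 24)) := by
    rw [chiralPhase, ← Complex.exp_add]
    congr 1
    ring
  rw [partialRotation, e₁, e₂, e₃, e₄, hsplit]
  push_cast
  ring

omit [Finite A] in
theorem HasRotationPhase.unique {E : EdgeCFT C} {n : ℕ} {z w : ℂ} (hz : E.HasRotationPhase n z)
    (hw : E.HasRotationPhase n w) : z = w :=
  tendsto_nhds_unique hz hw

omit [Finite A] in
theorem chiralPhase_ne_zero (n : ℕ) : E.chiralPhase n ≠ 0 := Complex.exp_ne_zero _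

omit [Finite A] in
theorem chiralPhase_eq_one (h : E.chiralCentralCharge = 0) (n : ℕ) : E.chiralPhase n = 1 := by
  simp [chiralPhase, h]

theorem hasRotationPhase_two_mul_dimSq :
    E.HasRotationPhase (2 * C.dimSq) (E.chiralPhase (2 * C.dimSq)) := by
  have hD : (C.dimSq : ℂ) ≠ 0 := by exact_mod_cast C.dimSq_pos.ne'
  have hG := C.gaussSum_of_fsExponent_dvd C.fsExponent_dvd_two_mul
  have h := E.hasRotationPhase (n := 2 * C.dimSq) (by have := C.dimSq_pos; lia) (by rwa [hG])
  rwa [AbelianTQFT.higherCentralCharge, hG, Complex.norm_natCast, Complex.ofReal_natCast,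
    div_self hD, mul_one] at h

theorem hasRotationPhase_rotationUnit (p : C.dimSq.primeFactors) {m : ℕ} (hm : m.Coprime p) :
    E.HasRotationPhase (m * C.rotationUnit p) (E.chiralPhase (m * C.rotationUnit p) *
      (C.primary (p : ℕ)).higherCentralCharge (m * C.rotationUnit p)) := by
  obtain ⟨hG, h⟩ := C.higherCentralCharge_rotationUnit p hm
  have hp := Nat.prime_of_mem_primeFactors p.2
  rw [← h]
  refine E.hasRotationPhase (Nat.pos_of_ne_zero fun h0 => ?_) hG
  have := hm.mul_left (C.rotationUnit_coprime p)
  rw [h0, Nat.coprime_zero_left] at this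
  exact hp.one_lt.ne' this

theorem hasRotationPhase_chiralPhase_iff (p : C.dimSq.primeFactors) {m : ℕ} (hm : m.Coprime p) :
    E.HasRotationPhase (m * C.rotationUnit p) (E.chiralPhase (m * C.rotationUnit p)) ↔
      (C.primary (p : ℕ)).higherCentralCharge (m * C.rotationUnit p) = 1 := by
  have h := E.hasRotationPhase_rotationUnit p hm
  refine ⟨fun h' => ?_, fun h1 => by rwa [h1, mul_one] at h⟩
  exact (mul_eq_left₀ (E.chiralPhase_ne_zero _)).1 (h.unique h')

theorem admitsGappedEdge_iff_hasRotationPhase : C.AdmitsGappedEdge ↔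
    ∀ p : C.dimSq.primeFactors, ∀ m : ℕ, 1 ≤ m → m ≤ (p : ℕ) ^ C.kTilde p → m.Coprime p →
      E.HasRotationPhase (m * C.rotationUnit p) (E.chiralPhase (m * C.rotationUnit p)) := by
  rw [C.admitsGappedEdge_iff_rotationUnit]
  refine forall₅_congr fun p m _ _ hm => ?_
  rw [E.hasRotationPhase_chiralPhase_iff p hm]

end EdgeCFT

end

/-! ### Higher central charges and partial rotations -/

theorem mainTheorem2 {A : Type*} [AddCommGroup A] [Finite A] (C : AbelianTQFT A) :
    -- the Frobenius–Schur exponent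
    C.fsExponent ∣ 2 * C.dimSq ∧
    -- prime-power factorization of the theory, of its exponent, and of the gapped-edge condition
    C.Equivalent (AbelianTQFT.deligneProduct
      fun p : C.dimSq.primeFactors => C.primary (p : ℕ)) ∧
    C.fsExponent = ∏ p : C.dimSq.primeFactors, (C.primary (p : ℕ)).fsExponent ∧
    (C.AdmitsGappedEdge ↔
      ∀ p : C.dimSq.primeFactors, (C.primary (p : ℕ)).AdmitsGappedEdge) ∧
    (∀ p : C.dimSq.primeFactors,
      (C.primary (p : ℕ)).dimSq = (p : ℕ) ^ C.kExp p ∧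
      (∃ l : ℕ, 1 ≤ l ∧ l ≤ C.kTilde p ∧ (C.primary (p : ℕ)).fsExponent = (p : ℕ) ^ l) ∧
      -- the higher central charges decide whether each factor admits a gapped edge
      ((C.primary (p : ℕ)).AdmitsGappedEdge ↔
        ∀ n : ℕ, 1 ≤ n → n ≤ (C.primary (p : ℕ)).fsExponent → n.Coprime p →
          (C.primary (p : ℕ)).higherCentralCharge n = 1) ∧
      -- the Gauss sums of the whole theory at `n = m * (2 𝒟² / p ^ k̃)`
      (∀ m : ℕ, m.Coprime p →
        (C.primary (p : ℕ)).gaussSum (m * C.rotationUnit p) ≠ 0 ∧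
        ∃ r : ℝ, 0 < r ∧ C.gaussSum (m * C.rotationUnit p) =
          r * (C.primary (p : ℕ)).higherCentralCharge (m * C.rotationUnit p)) ∧
      -- these `n` exhaust all the higher central charges needed
      (∀ n : ℕ, 1 ≤ n → n ≤ (C.primary (p : ℕ)).fsExponent → n.Coprime p →
        ∃ m : ℕ, 1 ≤ m ∧ m ≤ (p : ℕ) ^ C.kTilde p ∧ m.Coprime p ∧
          m * C.rotationUnit p ≡ n [MOD (C.primary (p : ℕ)).fsExponent] ∧
          (C.primary (p : ℕ)).higherCentralCharge (m * C.rotationUnit p) =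
            (C.primary (p : ℕ)).higherCentralCharge n)) ∧
    -- partial rotations of a phase with topological order `C`
    ∀ E : EdgeCFT C,
      (∀ n : ℕ, 1 ≤ n → C.gaussSum n ≠ 0 →
        E.HasRotationPhase n (E.chiralPhase n * C.higherCentralCharge n)) ∧
      E.HasRotationPhase (2 * C.dimSq) (E.chiralPhase (2 * C.dimSq)) ∧
      (∀ p : C.dimSq.primeFactors, ∀ m : ℕ, m.Coprime p →
        E.HasRotationPhase (m * C.rotationUnit p) (E.chiralPhase (m * C.rotationUnit p) *
          (C.primary (p : ℕ)).higherCentralCharge (m * C.rotationUnit p))) ∧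
      -- `c₋` and the partial rotations decide whether the edge is gappable
      (C.AdmitsGappedEdge ↔
        ∀ p : C.dimSq.primeFactors, ∀ m : ℕ, 1 ≤ m → m ≤ (p : ℕ) ^ C.kTilde p → m.Coprime p →
          E.HasRotationPhase (m * C.rotationUnit p) (E.chiralPhase (m * C.rotationUnit p))) ∧
      (E.EdgeGappable ↔ E.chiralCentralCharge = 0 ∧
        ∀ p : C.dimSq.primeFactors, ∀ m : ℕ, 1 ≤ m → m ≤ (p : ℕ) ^ C.kTilde p → m.Coprime p →
          E.HasRotationPhase (m * C.rotationUnit p) 1) := by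
  refine ⟨C.fsExponent_dvd_two_mul, C.equivalent_deligneProduct, C.fsExponent_eq_prod,
    C.admitsGappedEdge_iff_primary, fun p => ⟨C.dimSq_primary p, C.exists_fsExponent_primary p,
      C.admitsGappedEdge_primary_iff p, fun m hm => ⟨AbelianTQFT.gaussSum_ne_zero _
        (C.coprime_mul_rotationUnit p hm), C.exists_gaussSum_rotationUnit p hm⟩,
      fun n _ _ hn => ?_⟩,
    fun E => ⟨fun n hn hG => E.hasRotationPhase hn hG, E.hasRotationPhase_two_mul_dimSq,
      fun p m hm => E.hasRotationPhase_rotationUnit p hm,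
      E.admitsGappedEdge_iff_hasRotationPhase, and_congr_right fun hc => ?_⟩⟩
  · obtain ⟨m, h1, h2, h3, h4⟩ := C.exists_mul_rotationUnit_modEq p hn
    exact ⟨m, h1, h2, h3, h4, AbelianTQFT.higherCentralCharge_congr _ h4⟩
  · rw [E.admitsGappedEdge_iff_hasRotationPhase]
    simp only [E.chiralPhase_eq_one hc]
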